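/- There is an absolute constant $C$ such that the following holds for every real $p\ge 2$, all $d\ge 0$, $n\ge 2$, every $A\in\mathbb R^{d\times n}$, every $b\in\mathbb R^d$ for which $Ax=b$ is solvable, and every $0<\epsilon\le 1$. The iterative refinement algorithm described below, run in exact real arithmetic, terminates with a vector $x$ such that $Ax=b$ and $$\|x\|_p\le(1+\epsilon)\min_{y:\,Ay=b}\|y\|_p .$$ It solves at most $C\,p^2\log n\,\log(n/\epsilon)$ residual subproblems. For each of them it makes at most $C\,n^{\frac{p-2}{3p-2}}$ calls to a solver of linear systems of the form $\widetilde A D\widetilde A^{\top}\phi=z$, where $D$ is a nonnegative diagonal matrix, $\widetilde A$ is $A$ with a single row appended, and $z$ is the zero vector with a single nonzero coordinate appended. (The solver returns an arbitrary solution of any such system that has one.) *Main algorithm.* Operations on vectors are coordinatewise. Put $\kappa=1$ if $\frac p2(\log_2 n-1)\le\log_2 n$, and $\kappa=\frac p{p-2}$ otherwise. Start from $x=\arg\min_{Ax=b}\|x\|_2$ and $M=\|x\|_p^p/(16p)$. While $M>\frac{\epsilon}{16p(1+\epsilon)}\|x\|_p^p$: let $g=|x|^{p-2}x$ and $R=2|x|^{p-2}$,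 and call the residual solver with $P=\frac p2$, appended row $g$, right-hand side $c=\frac M2$, $\theta=M^{(2-p)/p}R$ and target $M'=2\sqrt\kappa\,M^{1/p}$. If it returns a certificate, or a vector $\Delta$ with $\langle R,\Delta^2\rangle\ge 2M$, replace $M$ by $M/2$; otherwise it has returned a vector $\Delta$, and $x$ is replaced by $x-\frac{\Delta}{64p\kappa}$. At the end return $x$. *Residual solver* for $\min\{\|\Delta^2\|_P+\langle\theta,\Delta^2\rangle:\ A\Delta=0,\ \langle g,\Delta\rangle=c\}$ with target $M'$; let $\frac1P+\frac1q=1$. For $r>0$ write $\Delta(r)=\arg\min\{\langle r+\theta,\Delta^2\rangle: A\Delta=0,\ \langle g,\Delta\rangle=c\}$. It is computed with one call to the solver, as $\Delta(r)=D\widetilde A^\top\phi$, where $\widetilde A$ is $A$ with the row $g^\top$ appended, $D=\mathrm{diag}(r+\theta)^{-1}$ and $\widetilde AD\widetilde A^\top\phi=(0,c)$. If the constraints are infeasible (the returned $\phi$ does not solve the system), the residual solver returns $r$ as a certificate. (i) If $P(\log_2 n-1)\le\log_2 n$: take $r=n^{-1/q}$ in every coordinate; return $\Delta(r)$ if $\|\Delta(r)\|_{2P}\le2M'$,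 and the certificate $r$ otherwise. (ii) Otherwise start with $r=\frac{2q-1}{2q\,n^{1/q}}$ in every coordinate, $s=0$, $k=0$. While $\sum_i r_i^q\le1$: let $\Delta=\Delta(r)$ and $v_i=\Delta_i^2\|r\|_q^{q-1}/r_i^{q-1}$; put $\gamma_i=v_i/M'^2$ if $v_i\ge2M'^2$ and $\gamma_i=1$ otherwise, and $\alpha_i=\gamma_i^{1/q}$. If all $\alpha_i=1$, return $\Delta$. Replace $r$ by $\alpha r$. If $\alpha_i\le n^{2/(2q+1)}$ for all $i$, add $\Delta$ to $s$ and $1$ to $k$. If $k>0$ and $\|s/k\|_{2P}\le2M'$, return $s/k$. If the loop ends without returning, return the certificate $r$. -/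

import Mathlib

open Matrix

noncomputable section

namespace LpIRLS

/-- The `ℓ_p` norm of a real vector. -/
def lpNorm {n : ℕ} (p : ℝ) (x : Fin n → ℝ) : ℝ := ‖WithLp.toLp (ENNReal.ofReal p) x‖

/-! ### Linear systems and the linear system solver -/

/-- The data of a linear system `Ã D Ãᵀ φ = z`: the row `g` that is appended to `A` to form `Ã`,
the diagonal of `D`, and the last coordinate of `z`, whose other coordinates are zero. -/
structure SystemQuery (n : ℕ) where
  row : Fin n → ℝ
  diag : Fin n → ℝ
  rhs : ℝ

/-- `Ã`: the matrix `A` with the row `g` appended at the bottom. -/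
def appendRow {d n : ℕ} (A : Matrix (Fin d) (Fin n) ℝ) (g : Fin n → ℝ) :
    Matrix (Fin (d + 1)) (Fin n) ℝ :=
  Matrix.of (Fin.snoc (α := fun _ => Fin n → ℝ) A g)

/-- `z`: the zero vector of length `d` with the coordinate `c` appended. -/
def appendCoord (d : ℕ) (c : ℝ) : Fin (d + 1) → ℝ :=
  Fin.snoc (α := fun _ => ℝ) (0 : Fin d → ℝ) c

/-- `D` is nonnegative and the appended coordinate of `z` is nonzero. -/
def SystemQuery.WellFormed {n : ℕ} (Q : SystemQuery n) : Prop :=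
  (∀ i, 0 ≤ Q.diag i) ∧ Q.rhs ≠ 0

/-- `Ã D Ãᵀ φ = z`. -/
def SystemQuery.IsSolution {d n : ℕ} (A : Matrix (Fin d) (Fin n) ℝ) (Q : SystemQuery n)
    (φ : Fin (d + 1) → ℝ) : Prop :=
  (appendRow A Q.row * Matrix.diagonal Q.diag * (appendRow A Q.row)ᵀ) *ᵥ φ = appendCoord d Q.rhs

/-- `solve` is a linear system solver for `A`: it returns a solution (any one of them) of each
system `Ã D Ãᵀ φ = z` with nonnegative `D` that has a solution; on a system without a solution
it may return anything. -/
def SolvesSystems {d n : ℕ} (A : Matrix (Fin d) (Fin n) ℝ)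
    (solve : SystemQuery n → Fin (d + 1) → ℝ) : Prop :=
  ∀ Q : SystemQuery n, Q.WellFormed → (∃ φ, Q.IsSolution A φ) → Q.IsSolution A (solve Q)

/-- The system that is solved to find `argmin {⟨w, x²⟩ : A x = 0, ⟨g, x⟩ = c}`. -/
def lsQuery {n : ℕ} (g : Fin n → ℝ) (c : ℝ) (w : Fin n → ℝ) : SystemQuery n where
  row := g
  diag := fun i => (w i)⁻¹
  rhs := c

open Classical in
/-- The minimizer `D Ãᵀ φ`, `D = diag(w)⁻¹`, of `⟨w, x²⟩` subject to `A x = 0` and `⟨g, x⟩ = c`,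
found with one call to the solver; `none` if the answer of the solver does not solve the system
(so that, for positive `w`, the constraints are infeasible). -/
def leastSquares {d n : ℕ} (A : Matrix (Fin d) (Fin n) ℝ)
    (solve : SystemQuery n → Fin (d + 1) → ℝ)
    (g : Fin n → ℝ) (c : ℝ) (w : Fin n → ℝ) : Option (Fin n → ℝ) :=
  if (lsQuery g c w).IsSolution A (solve (lsQuery g c w)) then
    some (fun i => (w i)⁻¹ * ((appendRow A g)ᵀ *ᵥ solve (lsQuery g c w)) i)
  else none

/-! ### The IRLS residual solver -/

/-- Input of the residual solver: the problem is
`min {‖x²‖_P + ⟨θ, x²⟩ : A x = 0, ⟨g, x⟩ = c}`, and `M` is the target value. -/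
structure ResidualInput (n : ℕ) where
  P : ℝ
  g : Fin n → ℝ
  c : ℝ
  θ : Fin n → ℝ
  M : ℝ

/-- Output of the residual solver: a primal vector, or a dual vector that certifies approximate
infeasibility of the target value. -/
inductive ResidualOutput (n : ℕ) where
  | primal (x : Fin n → ℝ) : ResidualOutput n
  | certificate (r : Fin n → ℝ) : ResidualOutput n

/-- State of the loop: the dual vector `r`, and the sum `s` of the `k` primal iterates found in
iterations in which `r` changed only a little. -/
structure ResidualState (n : ℕ) where
  r : Fin n → ℝ
  s : Fin n → ℝ
  k : ℕ

/-- The regime `P ≤ log n / (log n - 1)`, logarithms to base `2`, with the denominator cleared. -/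
def SmallExponent (n : ℕ) (P : ℝ) : Prop := P * (Real.logb 2 n - 1) ≤ Real.logb 2 n

/-- The exponent `q` with `1/P + 1/q = 1` (only used for `P > 1`). -/
def dualExponent (P : ℝ) : ℝ := P / (P - 1)

/-- The one linear system solved in an iteration that starts from the dual vector `r`. -/
def residualQuery {n : ℕ} (I : ResidualInput n) (r : Fin n → ℝ) : SystemQuery n :=
  lsQuery I.g I.c (fun i => r i + I.θ i)

open Classical in
/-- The residual solver in the regime of small `P`: `r = n^(-1/q)`, one least squares problem. -/
def residualSmall {d n : ℕ} (A : Matrix (Fin d) (Fin n) ℝ)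
    (solve : SystemQuery n → Fin (d + 1) → ℝ) (I : ResidualInput n) (r : Fin n → ℝ) :
    ResidualOutput n :=
  match leastSquares A solve I.g I.c (fun i => r i + I.θ i) with
  | none => .certificate r
  | some x => if lpNorm (2 * I.P) x ≤ 2 * I.M then .primal x else .certificate r

open Classical in
/-- The multipliers `γ`. -/
def gammaMul {n : ℕ} (I : ResidualInput n) (r x : Fin n → ℝ) : Fin n → ℝ := fun i =>
  let q := dualExponent I.P
  let v := x i ^ 2 * lpNorm q r ^ (q - 1) / r i ^ (q - 1)
  if 2 * I.M ^ 2 ≤ v then v / I.M ^ 2 else 1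

/-- The multipliers `α = γ^(1/q)`. -/
def alphaMul {n : ℕ} (I : ResidualInput n) (r x : Fin n → ℝ) : Fin n → ℝ := fun i =>
  gammaMul I r x i ^ (1 / dualExponent I.P)

open Classical in
/-- The new `s` and `k`: the iterate `x` is recorded if `α ≤ n^(2/(2q+1))`. -/
def recordIterate {n : ℕ} (I : ResidualInput n) (st : ResidualState n) (x : Fin n → ℝ) :
    (Fin n → ℝ) × ℕ :=
  if ∀ i, alphaMul I st.r x i ≤ (n : ℝ) ^ (2 / (2 * dualExponent I.P + 1)) then
    (st.s + x, st.k + 1)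
  else (st.s, st.k)

open Classical in
/-- One pass through the body of the loop: either the loop continues from a new state or the
solver returns. -/
def residualBody {d n : ℕ} (A : Matrix (Fin d) (Fin n) ℝ)
    (solve : SystemQuery n → Fin (d + 1) → ℝ) (I : ResidualInput n) (st : ResidualState n) :
    ResidualState n ⊕ ResidualOutput n :=
  match leastSquares A solve I.g I.c (fun i => st.r i + I.θ i) with
  | none => .inr (.certificate st.r)
  | some x =>
    if ∀ i, alphaMul I st.r x i = 1 then .inr (.primal x)
    else
      let s' := (recordIterate I st x).1
      let k' := (recordIterate I st x).2
      if 0 < k' ∧ lpNorm (2 * I.P) (fun i => s' i / k') ≤ 2 * I.M then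
        .inr (.primal (fun i => s' i / k'))
      else .inl ⟨fun i => alphaMul I st.r x i * st.r i, s', k'⟩

/-- `ResidualLoop A solve I st L out`: the loop `while ‖r^q‖₁ ≤ 1`, started in the state `st`,
terminates with output `out`, and `L` is the list of the calls to the solver that it makes. -/
inductive ResidualLoop {d n : ℕ} (A : Matrix (Fin d) (Fin n) ℝ)
    (solve : SystemQuery n → Fin (d + 1) → ℝ) (I : ResidualInput n) :
    ResidualState n → List (SystemQuery n) → ResidualOutput n → Prop
  | exit (st : ResidualState n) (hst : 1 < ∑ i, st.r i ^ dualExponent I.P) :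
      ResidualLoop A solve I st [] (.certificate st.r)
  | ret (st : ResidualState n) (out : ResidualOutput n)
      (hst : ∑ i, st.r i ^ dualExponent I.P ≤ 1)
      (hbody : residualBody A solve I st = .inr out) :
      ResidualLoop A solve I st [residualQuery I st.r] out
  | next (st st' : ResidualState n) (L : List (SystemQuery n)) (out : ResidualOutput n)
      (hst : ∑ i, st.r i ^ dualExponent I.P ≤ 1)
      (hbody : residualBody A solve I st = .inl st')
      (hrest : ResidualLoop A solve I st' L out) :
      ResidualLoop A solve I st (residualQuery I st.r :: L) out

/-- Initial dual vector in the regime of small `P`: all coordinates are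
`n^(-1/q) = n^(-(P-1)/P)`. -/
def initSmall (n : ℕ) (P : ℝ) : Fin n → ℝ := fun _ => (n : ℝ) ^ (-((P - 1) / P))

/-- Initial state of the loop: all coordinates of `r` are `(2q-1)/(2 q n^(1/q))`. -/
def initState (n : ℕ) (P : ℝ) : ResidualState n where
  r := fun _ => (2 * dualExponent P - 1) / (2 * dualExponent P * (n : ℝ) ^ (1 / dualExponent P))
  s := 0
  k := 0

/-- `ResidualSolver A solve I L out`: the residual solver on input `I` terminates with output
`out`, and `L` is the list of the calls to the linear system solver that it makes. -/
inductive ResidualSolver {d n : ℕ} (A : Matrix (Fin d) (Fin n) ℝ)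
    (solve : SystemQuery n → Fin (d + 1) → ℝ) (I : ResidualInput n) :
    List (SystemQuery n) → ResidualOutput n → Prop
  | small (h : SmallExponent n I.P) :
      ResidualSolver A solve I [residualQuery I (initSmall n I.P)]
        (residualSmall A solve I (initSmall n I.P))
  | large (h : ¬ SmallExponent n I.P) (L : List (SystemQuery n)) (out : ResidualOutput n)
      (hloop : ResidualLoop A solve I (initState n I.P) L out) :
      ResidualSolver A solve I L out

/-! ### Iterative refinement -/

open Classical in
/-- `κ = 1` if `p ≤ 2 log n / (log n - 1)` and `κ = p / (p - 2)` otherwise. -/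
def kappa (n : ℕ) (p : ℝ) : ℝ := if SmallExponent n (p / 2) then 1 else p / (p - 2)

/-- The weights `R = 2 |x|^(p-2)`. -/
def weightR {n : ℕ} (p : ℝ) (x : Fin n → ℝ) : Fin n → ℝ := fun i => 2 * |x i| ^ (p - 2)

/-- The residual problem at the iterate `x` with the current bound `M`: exponent `p/2`, appended
row `g = |x|^(p-2) x`, right-hand side `M/2`, `θ = M^((2-p)/p) R`, target `2 √κ M^(1/p)`. -/
def residualInput {n : ℕ} (p : ℝ) (x : Fin n → ℝ) (M : ℝ) : ResidualInput n where
  P := p / 2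
  g := fun i => |x i| ^ (p - 2) * x i
  c := M / 2
  θ := fun i => M ^ ((2 - p) / p) * weightR p x i
  M := 2 * Real.sqrt (kappa n p) * M ^ (1 / p)

/-- The output of the residual solver leads to no step: it is an infeasibility certificate, or a
vector `Δ` with `⟨R, Δ²⟩ ≥ 2 M`. -/
def NoStep {n : ℕ} (p : ℝ) (x : Fin n → ℝ) (M : ℝ) : ResidualOutput n → Prop
  | .certificate _ => True
  | .primal Δ => 2 * M ≤ ∑ i, weightR p x i * Δ i ^ 2

/-- `RefineLoop A p ε solve x M log y`: the refinement loop, started from the iterate `x` and the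
bound `M`, terminates and returns `y`. The list `log` has one entry for each residual subproblem
solved: the list of the calls to the linear system solver made for that subproblem. -/
inductive RefineLoop {d n : ℕ} (A : Matrix (Fin d) (Fin n) ℝ) (p ε : ℝ)
    (solve : SystemQuery n → Fin (d + 1) → ℝ) :
    (Fin n → ℝ) → ℝ → List (List (SystemQuery n)) → (Fin n → ℝ) → Prop
  | exit (x : Fin n → ℝ) (M : ℝ)
      (hM : M ≤ ε / (16 * p * (1 + ε)) * lpNorm p x ^ p) :
      RefineLoop A p ε solve x M [] x
  | halve (x : Fin n → ℝ) (M : ℝ) (L : List (SystemQuery n)) (out : ResidualOutput n)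
      (log : List (List (SystemQuery n))) (y : Fin n → ℝ)
      (hM : ε / (16 * p * (1 + ε)) * lpNorm p x ^ p < M)
      (hres : ResidualSolver A solve (residualInput p x M) L out)
      (hout : NoStep p x M out)
      (hrest : RefineLoop A p ε solve x (M / 2) log y) :
      RefineLoop A p ε solve x M (L :: log) y
  | step (x : Fin n → ℝ) (M : ℝ) (L : List (SystemQuery n)) (Δ : Fin n → ℝ)
      (log : List (List (SystemQuery n))) (y : Fin n → ℝ)
      (hM : ε / (16 * p * (1 + ε)) * lpNorm p x ^ p < M)
      (hres : ResidualSolver A solve (residualInput p x M) L (.primal Δ))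
      (hout : ¬ NoStep p x M (.primal Δ))
      (hrest : RefineLoop A p ε solve (fun i => x i - Δ i / (64 * p * kappa n p)) M log y) :
      RefineLoop A p ε solve x M (L :: log) y

/-- `x = argmin {‖x‖₂ : A x = b}`. -/
def IsLeastNormSolution {d n : ℕ} (A : Matrix (Fin d) (Fin n) ℝ) (b : Fin d → ℝ)
    (x : Fin n → ℝ) : Prop :=
  A *ᵥ x = b ∧ ∀ y, A *ᵥ y = b → lpNorm 2 x ≤ lpNorm 2 y

/-- `Run A b p ε solve log y`: the algorithm, started from the solution `x₀` of least `ℓ₂` norm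
and from `M = ‖x₀‖_p^p / (16 p)`, terminates and returns `y`; `log` lists, for each residual
subproblem, the calls to the linear system solver. -/
def Run {d n : ℕ} (A : Matrix (Fin d) (Fin n) ℝ) (b : Fin d → ℝ) (p ε : ℝ)
    (solve : SystemQuery n → Fin (d + 1) → ℝ)
    (log : List (List (SystemQuery n))) (y : Fin n → ℝ) : Prop :=
  ∃ x₀ : Fin n → ℝ, IsLeastNormSolution A b x₀ ∧
    RefineLoop A p ε solve x₀ (lpNorm p x₀ ^ p / (16 * p)) log y

end LpIRLS

end

/-!
The proof analyses the two nested loops of the algorithm separately.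

*Refinement.* Write `f x = ‖x‖_p^p`. The second order estimates `abs_sub_div_rpow_le` and
`le_abs_sub_rpow` compare `f` along a step with the residual function
`⟨g, δ⟩ - ⟨R, δ²⟩ - ‖δ‖_p^p`. The refinement loop keeps `f x - f y ≤ 16 p M` for all solutions `y`.
If the gap exceeds `8 p M`, a multiple of `(x - y) / 16` is feasible for the residual problem and has
value at most `9/8 M^(2/p)` (`residualValueLE_of_gap`), while the residual solver finds a usable step
whenever the optimal value is below `2 M^(2/p)`; so halving `M` is sound. A step lowers `f` by at
least `7/2048 · M / κ` (`lpNorm_rpow_step_le`). The loop therefore makes `O(p κ)` steps between two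
halvings and, as the starting point is optimal up to the factor `n^(p/2-1)`, `O(p log (n/ε))`
halvings; moreover `κ = O(log n)`. All this is in the potential `refinePotential`, which drops by `1`
with each residual problem and serves both for termination and for the count.

*Residual solver.* For small `P`, the weight `n^(-1/q)` is at least `1/2`, so that one least squares
problem is enough. Otherwise, with `T = M'²`, each update of the dual vector `r` raises the minimal
energy `min ⟨r + θ, y²⟩` by at least `T` times the increase of `‖r‖_q` (`energy_update`). As
`‖r‖_q = 1 - 1/(2q)` initially, a final vector with `‖r‖_q > 1` has energy at least
`‖r‖_q · T / (2q)`, and by Hölder's inequality it certifies that the optimal value is at least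
`T / (2q) = 2 M^(2/p)`.

*Iteration count.* Let `N = n^(1/(2q+1))`. An update with some `α_i > N²` raises `∑ r_i^q ≤ 1` by at
least `1/(4N)`, so there are `O(N)` of those. In the other iterations the iterate is recorded, and
`|Δ_i| ≤ 1.9 M' (r_i^((q-1)/2) + increase of Ψ(r_i))` for a potential `Ψ` with
`Ψ(ρ) ≤ 40 N ρ^((q-1)/2)` (`exists_potential`). The vector `r^((q-1)/2)` has `2P`-norm at most `1`
as long as `∑ r_i^q ≤ 1`, so the average of `k` recorded iterates has norm at most
`1.9 M' (1 + 40 N / k)`, which is below `2 M'` once `k` exceeds a constant multiple of `N`.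
-/

noncomputable section

namespace LpIRLS

/-! ### The `ℓ_p` norm as a power sum -/

lemma lpNorm_eq {n : ℕ} {p : ℝ} (hp : 0 < p) (x : Fin n → ℝ) :
    lpNorm p x = (∑ i, |x i| ^ p) ^ (1 / p) := by
  have h : (ENNReal.ofReal p).toReal = p := ENNReal.toReal_ofReal hp.le
  rw [lpNorm, PiLp.norm_eq_sum (by rw [h]; exact hp)]
  simp [h, Real.norm_eq_abs]

lemma sum_abs_rpow_nonneg {n : ℕ} (p : ℝ) (x : Fin n → ℝ) : 0 ≤ ∑ i, |x i| ^ p :=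
  Finset.sum_nonneg fun _ _ => Real.rpow_nonneg (abs_nonneg _) _

lemma lpNorm_rpow {n : ℕ} {p : ℝ} (hp : 0 < p) (x : Fin n → ℝ) :
    lpNorm p x ^ p = ∑ i, |x i| ^ p := by
  rw [lpNorm_eq hp, ← Real.rpow_mul (sum_abs_rpow_nonneg p x), one_div,
    inv_mul_cancel₀ hp.ne', Real.rpow_one]

lemma lpNorm_nonneg {n : ℕ} {p : ℝ} (hp : 0 < p) (x : Fin n → ℝ) : 0 ≤ lpNorm p x := by
  rw [lpNorm_eq hp]
  exact Real.rpow_nonneg (sum_abs_rpow_nonneg p x) _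

lemma lpNorm_le_iff {n : ℕ} {p B : ℝ} (hp : 0 < p) (hB : 0 ≤ B) (x : Fin n → ℝ) :
    lpNorm p x ≤ B ↔ ∑ i, |x i| ^ p ≤ B ^ p := by
  rw [← lpNorm_rpow hp, Real.rpow_le_rpow_iff (lpNorm_nonneg hp x) hB hp]

/-- The `ℓ₁` norm of the squares against the power sum with exponent `2P`. -/
lemma sum_sq_rpow_le {n : ℕ} {P : ℝ} (hP : 1 ≤ P) (x : Fin n → ℝ) :
    (∑ i, x i ^ 2) ^ P ≤ (n : ℝ) ^ (P - 1) * ∑ i, |x i| ^ (2 * P) := by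
  have h := Real.rpow_sum_le_const_mul_sum_rpow Finset.univ (fun i => x i ^ 2) hP
  simp only [Finset.card_univ, Fintype.card_fin, abs_pow, sq_abs] at h
  refine h.trans (le_of_eq ?_)
  congr 1
  refine Finset.sum_congr rfl fun i _ => ?_
  rw [← sq_abs, ← Real.rpow_natCast, ← Real.rpow_mul (abs_nonneg _)]
  norm_num

lemma sum_rpow_two_mul_le {n : ℕ} {P : ℝ} (hP : 1 ≤ P) (x : Fin n → ℝ) :
    ∑ i, |x i| ^ (2 * P) ≤ (∑ i, x i ^ 2) ^ P := by
  have h0 : ∀ i, |x i| ^ (2 * P) = (x i ^ 2) ^ (P - 1) * x i ^ 2 := fun i => by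
    rcases eq_or_ne (x i) 0 with h | h
    · rw [h, abs_zero, Real.zero_rpow (by linarith)]; simp
    · rw [← Real.rpow_add_one (by positivity), ← sq_abs, ← Real.rpow_natCast,
        ← Real.rpow_mul (abs_nonneg _)]
      norm_num
  have hs : 0 ≤ ∑ i, x i ^ 2 := Finset.sum_nonneg fun _ _ => sq_nonneg _
  calc ∑ i, |x i| ^ (2 * P) ≤ ∑ i, (∑ j, x j ^ 2) ^ (P - 1) * x i ^ 2 := by
        refine Finset.sum_le_sum fun i _ => ?_
        rw [h0]
        refine mul_le_mul_of_nonneg_right (Real.rpow_le_rpow (sq_nonneg _) ?_ (by linarith))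
          (sq_nonneg _)
        exact Finset.single_le_sum (f := fun j => x j ^ 2) (fun _ _ => sq_nonneg _)
          (Finset.mem_univ i)
    _ = (∑ i, x i ^ 2) ^ P := by
        rw [← Finset.mul_sum]
        rcases hs.eq_or_lt with h | h
        · rw [← h, mul_zero, Real.zero_rpow (by linarith)]
        · rw [← Real.rpow_add_one h.ne']; ring_nf

/-! ### Second order estimates for `|x|^p` -/

lemma exp_le_quadratic {t : ℝ} (h : |t| ≤ 2) : Real.exp t ≤ 1 + t + 2 * t ^ 2 := by
  rw [abs_le] at h
  rcases le_or_gt t (-1) with h1 | h1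
  · have : Real.exp t ≤ 1 := Real.exp_le_one_iff.2 (by linarith)
    nlinarith
  rcases le_or_gt t 1 with h2 | h2
  · have := (abs_le.1 (Real.abs_exp_sub_one_sub_id_le (abs_le.2 ⟨h1.le, h2⟩))).2
    nlinarith [sq_nonneg t]
  · have h3 := (abs_le.1 (Real.abs_exp_sub_one_sub_id_le (x := t - 1)
      (abs_le.2 ⟨by linarith, by linarith⟩))).2
    have h4 : Real.exp t = Real.exp 1 * Real.exp (t - 1) := by rw [← Real.exp_add]; ring_nf
    have h5 := Real.exp_one_lt_d9
    have h6 : Real.exp (t - 1) ≤ t ^ 2 - t + 1 := by nlinarith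
    rw [h4]
    have : Real.exp 1 * Real.exp (t - 1) ≤ 2.72 * (t ^ 2 - t + 1) :=
      mul_le_mul (by linarith) h6 (Real.exp_pos _).le (by norm_num)
    nlinarith

lemma abs_one_sub_div_rpow_le {p : ℝ} (hp : 2 ≤ p) (u : ℝ) :
    |1 - u / p| ^ p ≤ 1 - u + 2 * u ^ 2 + |u| ^ p := by
  have hp0 : 0 < p := by linarith
  rcases le_or_gt |u| 2 with h | h
  · have hu := abs_le.1 h
    have h1 : 0 ≤ 1 - u / p := by
      rw [sub_nonneg, div_le_one hp0]; linarith
    have h2 : |1 - u / p| ^ p ≤ Real.exp (-u) := by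
      rw [abs_of_nonneg h1]
      calc (1 - u / p) ^ p ≤ (Real.exp (-(u / p))) ^ p := by
            refine Real.rpow_le_rpow h1 ?_ hp0.le
            have := Real.add_one_le_exp (-(u / p)); linarith
        _ = Real.exp (-u) := by
            rw [← Real.exp_mul]; congr 1; field_simp
    have h3 := exp_le_quadratic (t := -u) (by rwa [abs_neg])
    have h4 := Real.rpow_nonneg (abs_nonneg u) p
    nlinarith
  · have h1 : |1 - u / p| ≤ |u| := by
      have : |u / p| ≤ |u| / 2 := by
        rw [abs_div, abs_of_pos hp0]
        exact div_le_div_of_nonneg_left (abs_nonneg _) (by norm_num) hp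
      have := abs_sub (1 : ℝ) (u / p)
      rw [abs_one] at this
      linarith
    have h2 := Real.rpow_le_rpow (abs_nonneg _) h1 hp0.le
    nlinarith [sq_nonneg (u - 1 / 4)]

lemma le_abs_one_sub_rpow {p : ℝ} (hp : 2 ≤ p) (t : ℝ) :
    1 - p * t + p / 8 * t ^ 2 + 16 * p * (|t| / 16) ^ p ≤ |1 - t| ^ p := by
  have hp0 : 0 < p := by linarith
  have hb : 1 - p * t + p / 2 * t ^ 2 ≤ |1 - t| ^ p := by
    have h := one_add_mul_self_le_rpow_one_add (s := -2 * t + t ^ 2) (p := p / 2)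
      (by nlinarith [sq_nonneg (1 - t)]) (by linarith)
    have h2 : (1 + (-2 * t + t ^ 2)) ^ (p / 2) = |1 - t| ^ p := by
      rw [show 1 + (-2 * t + t ^ 2) = |1 - t| ^ 2 by rw [sq_abs]; ring, ← Real.rpow_natCast,
        ← Real.rpow_mul (abs_nonneg _)]
      congr 1; push_cast; ring
    rw [h2] at h
    linarith
  rcases le_or_gt |t| 16 with h | h
  · have h1 : (|t| / 16) ^ p ≤ (|t| / 16) ^ (2 : ℝ) :=
      Real.rpow_le_rpow_of_exponent_ge_of_imp (by positivity) (by linarith) hp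
        (fun _ h => by linarith)
    have h2 : (|t| / 16) ^ (2 : ℝ) = t ^ 2 / 256 := by
      rw [Real.rpow_two, div_pow, sq_abs]; norm_num
    rw [h2] at h1
    nlinarith [mul_le_mul_of_nonneg_left h1 (by linarith : 0 ≤ 16 * p), sq_nonneg t,
      mul_nonneg hp0.le (sq_nonneg t)]
  · -- the quadratic terms take three quarters of `|1 - t|^p`, the power term one quarter
    have h1 : 15 * (|t| / 16) ≤ |1 - t| := by
      have := abs_sub_abs_le_abs_sub t 1
      rw [abs_one, abs_sub_comm] at this
      linarith
    have h2 : (15 : ℝ) ^ p * (|t| / 16) ^ p ≤ |1 - t| ^ p := by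
      rw [← Real.mul_rpow (by norm_num) (by positivity)]
      exact Real.rpow_le_rpow (by positivity) h1 hp0.le
    have h3 : 64 * p ≤ (15 : ℝ) ^ p := by
      have h := one_add_mul_self_le_rpow_one_add (s := 14) (p := p - 1) (by norm_num) (by linarith)
      have h4 : (15 : ℝ) ^ p = 15 * (1 + 14) ^ (p - 1) := by
        rw [show (1 + 14 : ℝ) = 15 by norm_num]
        nth_rw 2 [← Real.rpow_one 15]
        rw [← Real.rpow_add (by norm_num)]; congr 1; ring
      rw [h4]; nlinarith
    have h5 : 64 * p * (|t| / 16) ^ p ≤ |1 - t| ^ p :=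
      (mul_le_mul_of_nonneg_right h3 (Real.rpow_nonneg (by positivity) _)).trans h2
    have h6 : 1 - p * t ≤ p * t ^ 2 := by
      have := neg_abs_le t
      rw [← sq_abs t]
      nlinarith [mul_le_mul_of_nonneg_left h.le (mul_nonneg hp0.le (abs_nonneg t))]
    nlinarith

lemma abs_rpow_mul_inv {p x : ℝ} (hx : x ≠ 0) (u : ℝ) : |u / x| ^ p * |x| ^ p = |u| ^ p := by
  rw [← Real.mul_rpow (abs_nonneg _) (abs_nonneg _), ← abs_mul, div_mul_cancel₀ _ hx]

lemma abs_rpow_sub_two_mul {p x : ℝ} (hx : x ≠ 0) : |x| ^ p = |x| ^ (p - 2) * x ^ 2 := by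
  rw [← sq_abs x, ← Real.rpow_natCast, ← Real.rpow_add (abs_pos.2 hx)]
  congr 1; push_cast; ring

/-- Upper estimate for a step `δ / p`. -/
lemma abs_sub_div_rpow_le {p : ℝ} (hp : 2 ≤ p) (x δ : ℝ) :
    |x - δ / p| ^ p ≤
      |x| ^ p - |x| ^ (p - 2) * x * δ + 2 * |x| ^ (p - 2) * δ ^ 2 + |δ| ^ p := by
  have hp0 : 0 < p := by linarith
  rcases eq_or_ne x 0 with rfl | hx
  · have h1 : |0 - δ / p| ^ p ≤ |δ| ^ p := by
      refine Real.rpow_le_rpow (abs_nonneg _) ?_ hp0.le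
      rw [zero_sub, abs_neg, abs_div, abs_of_pos hp0]
      exact div_le_self (abs_nonneg _) (by linarith)
    have h2 : 0 ≤ 2 * |(0 : ℝ)| ^ (p - 2) * δ ^ 2 := by positivity
    have h3 : |(0 : ℝ)| ^ p = 0 := by rw [abs_zero, Real.zero_rpow hp0.ne']
    rw [h3, mul_zero, zero_mul, sub_zero, zero_add]
    exact h1.trans (le_add_of_nonneg_left h2)
  · have h := mul_le_mul_of_nonneg_right (abs_one_sub_div_rpow_le hp (δ / x))
      (Real.rpow_nonneg (abs_nonneg x) p)
    have h1 : 1 - δ / x / p = (x - δ / p) / x := by field_simp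
    rw [h1, abs_rpow_mul_inv hx, add_mul, abs_rpow_mul_inv hx] at h
    refine h.trans (le_of_eq ?_)
    rw [abs_rpow_sub_two_mul hx]
    field_simp

/-- Lower estimate for a step `16 δ`. -/
lemma le_abs_sub_rpow {p : ℝ} (hp : 2 ≤ p) (x δ : ℝ) :
    |x| ^ p - 16 * p * (|x| ^ (p - 2) * x * δ - 2 * |x| ^ (p - 2) * δ ^ 2 - |δ| ^ p) ≤
      |x - 16 * δ| ^ p := by
  have hp0 : 0 < p := by linarith
  rcases eq_or_ne x 0 with rfl | hx
  · have h := le_abs_one_sub_rpow hp (16 * δ)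
    have h3 : |(0 : ℝ)| ^ p = 0 := by rw [abs_zero, Real.zero_rpow hp0.ne']
    rw [h3, zero_sub, zero_sub, abs_neg, abs_mul, abs_of_pos (by norm_num : (0 : ℝ) < 16),
      Real.mul_rpow (by norm_num) (abs_nonneg _)]
    rcases hp.eq_or_lt with rfl | hp2
    · norm_num
      nlinarith [sq_nonneg δ]
    · rw [abs_zero, Real.zero_rpow (by linarith)]
      have h16 : 16 * p ≤ (16 : ℝ) ^ p := by
        have h := one_add_mul_self_le_rpow_one_add (s := 15) (p := p - 1) (by norm_num)
          (by linarith)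
        have h4 : (16 : ℝ) ^ p = 16 * (1 + 15) ^ (p - 1) := by
          rw [show (1 + 15 : ℝ) = 16 by norm_num]
          nth_rw 2 [← Real.rpow_one 16]
          rw [← Real.rpow_add (by norm_num)]; congr 1; ring
        rw [h4]; nlinarith
      nlinarith [mul_le_mul_of_nonneg_right h16 (Real.rpow_nonneg (abs_nonneg δ) p)]
  · have h := mul_le_mul_of_nonneg_right (le_abs_one_sub_rpow hp (16 * δ / x))
      (Real.rpow_nonneg (abs_nonneg x) p)
    have h1 : 1 - 16 * δ / x = (x - 16 * δ) / x := by field_simp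
    have h2 : |16 * δ / x| / 16 = |δ / x| := by
      rw [mul_div_assoc, abs_mul, abs_of_pos (by norm_num : (0 : ℝ) < 16)]; ring
    rw [h1, h2, abs_rpow_mul_inv hx, add_mul, mul_assoc (16 * p), abs_rpow_mul_inv hx] at h
    refine le_trans (le_of_eq ?_) h
    rw [abs_rpow_sub_two_mul hx]
    field_simp
    ring

/-! ### Weighted least squares by one linear system -/

/-- `A y = 0` and `⟨g, y⟩ = c`: the constraints of a residual problem. -/
def Feasible {d n : ℕ} (A : Matrix (Fin d) (Fin n) ℝ) (g : Fin n → ℝ) (c : ℝ)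
    (y : Fin n → ℝ) : Prop :=
  A *ᵥ y = 0 ∧ g ⬝ᵥ y = c

lemma appendRow_castSucc {d n : ℕ} (A : Matrix (Fin d) (Fin n) ℝ) (g : Fin n → ℝ) (j : Fin d) :
    appendRow A g j.castSucc = A j := by
  unfold appendRow
  exact Fin.snoc_castSucc (α := fun _ => Fin n → ℝ) _ _ _

lemma appendRow_last {d n : ℕ} (A : Matrix (Fin d) (Fin n) ℝ) (g : Fin n → ℝ) :
    appendRow A g (Fin.last d) = g := by
  unfold appendRow
  exact Fin.snoc_last (α := fun _ => Fin n → ℝ) _ _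

lemma appendRow_mulVec_eq_iff {d n : ℕ} {A : Matrix (Fin d) (Fin n) ℝ} {g : Fin n → ℝ} {c : ℝ}
    {y : Fin n → ℝ} : appendRow A g *ᵥ y = appendCoord d c ↔ Feasible A g c y := by
  constructor
  · intro h
    constructor
    · ext j
      have := congrFun h j.castSucc
      simpa [appendRow_castSucc, appendCoord, mulVec] using this
    · have := congrFun h (Fin.last d)
      simpa [appendRow_last, appendCoord, mulVec] using this
  · rintro ⟨h1, h2⟩
    ext j
    refine Fin.lastCases ?_ (fun j => ?_) j
    · simpa [appendRow_last, appendCoord, mulVec] using h2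
    · have := congrFun h1 j
      simpa [appendRow_castSucc, appendCoord, mulVec] using this

/-- With a positive diagonal `D`, the range of `B D Bᵀ` is that of `B`. -/
lemma exists_mul_diagonal_mul_transpose_mulVec {m n : ℕ} (B : Matrix (Fin m) (Fin n) ℝ)
    {D : Fin n → ℝ} (hD : ∀ i, 0 < D i) (y : Fin n → ℝ) :
    ∃ φ, (B * Matrix.diagonal D * Bᵀ) *ᵥ φ = B *ᵥ y := by
  set S : Matrix (Fin m) (Fin n) ℝ := B * Matrix.diagonal (fun i => √(D i)) with hS
  have hSS : S * Sᵀ = B * Matrix.diagonal D * Bᵀ := by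
    rw [hS, transpose_mul, diagonal_transpose, Matrix.mul_assoc, ← Matrix.mul_assoc (diagonal _),
      diagonal_mul_diagonal, ← Matrix.mul_assoc]
    congr 3
    ext i
    exact Real.mul_self_sqrt (hD i).le
  have hrange : LinearMap.range (S * Sᵀ).mulVecLin = LinearMap.range S.mulVecLin := by
    refine Submodule.eq_of_le_of_finrank_eq ?_ (rank_self_mul_transpose S)
    rw [mulVecLin_mul]
    exact LinearMap.range_comp_le_range _ _
  have hy : B *ᵥ y = S *ᵥ (fun i => (√(D i))⁻¹ * y i) := by
    rw [hS, ← mulVec_mulVec]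
    congr 1
    ext i
    rw [mulVec_diagonal, mul_inv_cancel_left₀ (Real.sqrt_pos.2 (hD i)).ne']
  have : B *ᵥ y ∈ LinearMap.range (S * Sᵀ).mulVecLin := by
    rw [hrange, hy]; exact ⟨_, rfl⟩
  obtain ⟨φ, hφ⟩ := this
  exact ⟨φ, by rw [← hSS]; exact hφ⟩

section

variable {d n : ℕ} {A : Matrix (Fin d) (Fin n) ℝ} {solve : SystemQuery n → Fin (d + 1) → ℝ}
  {g w : Fin n → ℝ} {c : ℝ}

lemma lsQuery_wellFormed (hc : c ≠ 0) (hw : ∀ i, 0 ≤ w i) : (lsQuery g c w).WellFormed :=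
  ⟨fun i => inv_nonneg.2 (hw i), hc⟩

/-- A failed call to the solver certifies that the constraints are infeasible. -/
lemma not_feasible_of_leastSquares_eq_none (hsolve : SolvesSystems A solve) (hc : c ≠ 0)
    (hw : ∀ i, 0 < w i) (h : leastSquares A solve g c w = none) (y : Fin n → ℝ) :
    ¬ Feasible A g c y := by
  intro hy
  unfold leastSquares at h
  split_ifs at h with h2
  refine h2 (hsolve _ (lsQuery_wellFormed hc fun i => (hw i).le) ?_)
  obtain ⟨φ, hφ⟩ := exists_mul_diagonal_mul_transpose_mulVec (appendRow A g)
    (fun i => inv_pos.2 (hw i)) y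
  exact ⟨φ, hφ.trans (appendRow_mulVec_eq_iff.2 hy)⟩

/-- The vector computed by the solver is feasible, and it is characterized as the weighted least
squares solution by orthogonality: `⟨w x, y⟩ = ⟨w x, x⟩` for every feasible `y`. -/
lemma leastSquares_spec (hw : ∀ i, 0 < w i) {x : Fin n → ℝ}
    (h : leastSquares A solve g c w = some x) :
    Feasible A g c x ∧
      ∀ y, Feasible A g c y → ∑ i, w i * x i * y i = ∑ i, w i * x i ^ 2 := by
  rw [leastSquares] at h
  split_ifs at h with hs
  set φ := solve (lsQuery g c w)
  have hx : x = Matrix.diagonal (fun i => (w i)⁻¹) *ᵥ ((appendRow A g)ᵀ *ᵥ φ) := by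
    rw [← Option.some.inj h]
    ext i
    rw [mulVec_diagonal]
  have hfeas : appendRow A g *ᵥ x = appendCoord d c := by
    rw [hx, mulVec_mulVec, mulVec_mulVec]
    exact hs
  have hinner : ∀ y, Feasible A g c y → ∑ i, w i * x i * y i = φ ⬝ᵥ appendCoord d c := by
    intro y hy
    rw [← appendRow_mulVec_eq_iff.2 hy, dotProduct_mulVec, ← mulVec_transpose]
    refine Finset.sum_congr rfl fun i _ => ?_
    rw [hx, mulVec_diagonal, mul_inv_cancel_left₀ (hw i).ne']
  have hf := appendRow_mulVec_eq_iff.1 hfeas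
  refine ⟨hf, fun y hy => ?_⟩
  rw [hinner y hy, ← hinner x hf]
  exact Finset.sum_congr rfl fun i _ => by ring

end

/-- Optimality of a weighted least squares solution. -/
lemma sum_weight_sq_le {n : ℕ} {w x y : Fin n → ℝ} (hw : ∀ i, 0 ≤ w i)
    (h : ∑ i, w i * x i * y i = ∑ i, w i * x i ^ 2) :
    ∑ i, w i * x i ^ 2 ≤ ∑ i, w i * y i ^ 2 := by
  have h1 : ∑ i, (2 * (w i * x i * y i) - w i * x i ^ 2) ≤ ∑ i, w i * y i ^ 2 :=
    Finset.sum_le_sum fun i _ => by nlinarith [mul_nonneg (hw i) (sq_nonneg (x i - y i))]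
  rw [Finset.sum_sub_distrib, ← Finset.mul_sum, h] at h1
  linarith

/-! ### A potential for the growth of one dual coordinate -/

/-- The common value of the coordinates of the initial dual vector. -/
def initEntry (n : ℕ) (q : ℝ) : ℝ := (2 * q - 1) / (2 * q * (n : ℝ) ^ (1 / q))

section

variable {n : ℕ} {q : ℝ}

lemma initEntry_pos (hn : 2 ≤ n) (hq : 1 < q) : 0 < initEntry n q := by
  have : (0 : ℝ) < n := by positivity
  unfold initEntry
  have : 0 < 2 * q - 1 := by linarith
  positivity

lemma rpow_mul_initEntry (hn : 2 ≤ n) (hq : 1 < q) :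
    (n : ℝ) ^ (1 / q) * initEntry n q = 1 - 1 / (2 * q) := by
  have : (0 : ℝ) < n := by positivity
  have h : 0 < (n : ℝ) ^ (1 / q) := Real.rpow_pos_of_pos this _
  unfold initEntry
  field_simp

lemma mul_initEntry_rpow (hn : 2 ≤ n) (hq : 1 < q) :
    (n : ℝ) * initEntry n q ^ q = (1 - 1 / (2 * q)) ^ q := by
  have : (0 : ℝ) < n := by positivity
  rw [← rpow_mul_initEntry hn hq, Real.mul_rpow (Real.rpow_nonneg this.le _)
    (initEntry_pos hn hq).le, ← Real.rpow_mul this.le, one_div,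
    inv_mul_cancel₀ (by positivity), Real.rpow_one]

lemma half_le_mul_initEntry_rpow (hn : 2 ≤ n) (hq : 1 < q) :
    1 / 2 ≤ (n : ℝ) * initEntry n q ^ q := by
  rw [mul_initEntry_rpow hn hq]
  have h1 : -1 ≤ -(1 / (2 * q)) := by
    rw [neg_le_neg_iff, div_le_one (by linarith)]; linarith
  have h := one_add_mul_self_le_rpow_one_add h1 hq.le
  rw [← sub_eq_add_neg] at h
  refine le_trans (le_of_eq ?_) h
  field_simp
  norm_num

/-- `(1 - 1/(2q))^(q-1)` is bounded below; only `2 / 0.6 ≤ 1.9²` matters. -/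
lemma rpow_sub_one_ge (hq : 1 < q) : 0.6 ≤ (1 - 1 / (2 * q)) ^ (q - 1) := by
  have h0 : 0 < 1 - 1 / (2 * q) := by
    rw [sub_pos, div_lt_one (by linarith)]; linarith
  have h1 := Real.one_sub_inv_le_log_of_pos h0
  have h2 : 1 - (1 - 1 / (2 * q))⁻¹ = -(1 / (2 * q - 1)) := by
    have : 2 * q - 1 ≠ 0 := by linarith
    have h3 : 1 - 1 / (2 * q) = (2 * q - 1) / (2 * q) := by field_simp
    rw [h3, inv_div]; field_simp; ring
  rw [h2] at h1
  have h3 : -(1 / 2) ≤ Real.log (1 - 1 / (2 * q)) * (q - 1) := by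
    have h4 : (q - 1) / (2 * q - 1) ≤ 1 / 2 := by
      rw [div_le_div_iff₀ (by linarith) (by norm_num)]; linarith
    have h5 := mul_le_mul_of_nonneg_right h1 (by linarith : 0 ≤ q - 1)
    have h6 : -(1 / (2 * q - 1)) * (q - 1) = -((q - 1) / (2 * q - 1)) := by ring
    linarith
  rw [Real.rpow_def_of_pos h0]
  refine le_trans ?_ (Real.exp_le_exp.2 h3)
  rw [Real.exp_neg, le_inv_comm₀ (by norm_num) (Real.exp_pos _)]
  have h7 : Real.exp (1 / 2) ^ 2 = Real.exp 1 := by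
    rw [← Real.exp_nat_mul]; norm_num
  have h8 := Real.exp_one_lt_d9
  nlinarith [Real.exp_pos (1 / 2)]

/-- `N = n^(1/(2q+1))`, which is `n^((p-2)/(3p-2))` when `q = p/(p-2)`. -/
def iterScale (n : ℕ) (q : ℝ) : ℝ := (n : ℝ) ^ (1 / (2 * q + 1))

lemma one_lt_iterScale (hn : 2 ≤ n) (hq : 1 < q) : 1 < iterScale n q :=
  Real.one_lt_rpow (by exact_mod_cast hn) (by positivity)

lemma iterScale_sq : iterScale n q ^ 2 = (n : ℝ) ^ (2 / (2 * q + 1)) := by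
  rw [iterScale, ← Real.rpow_natCast, ← Real.rpow_mul (Nat.cast_nonneg n)]
  congr 1; push_cast; ring

lemma iterScale_rpow (hq : 1 < q) : iterScale n q ^ (2 * q) * iterScale n q = n := by
  have : 0 < 2 * q + 1 := by linarith
  rw [iterScale, ← Real.rpow_add_one' (Real.rpow_nonneg (Nat.cast_nonneg n) _) this.ne',
    ← Real.rpow_mul (Nat.cast_nonneg n), one_div, inv_mul_cancel₀ this.ne', Real.rpow_one]

lemma log_iterScale (hn : 2 ≤ n) : Real.log (iterScale n q) = Real.log n / (2 * q + 1) := by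
  rw [iterScale, Real.log_rpow (by positivity)]; ring

lemma rpow_mul_log_le {N α : ℝ} (hα : (2 : ℝ) ≤ α ^ 2) (h0 : 0 < α) (hαN : α ≤ N ^ 2)
    (hN : 1 < N) : α ^ (1 / 2 : ℝ) * Real.log N ≤ 4 * N * Real.log α := by
  set y := α ^ (1 / 2 : ℝ) with hy
  have hy0 : 0 < y := Real.rpow_pos_of_pos h0 _
  have hlog : Real.log y = Real.log α / 2 := by rw [hy, Real.log_rpow h0]; ring
  have hyN : y ≤ N := by
    rw [hy, ← Real.sqrt_eq_rpow]; exact Real.sqrt_le_iff.2 ⟨by linarith, hαN⟩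
  have h1 : Real.log 2 ≤ 2 * Real.log α := by
    have := Real.log_le_log (by norm_num) hα
    rwa [Real.log_pow] at this
  have h2 := Real.log_two_gt_d9
  have h3 : Real.log N ≤ Real.log y + N / y - 1 := by
    have h4 := Real.log_le_sub_one_of_pos (div_pos (by linarith : 0 < N) hy0)
    rw [Real.log_div (by linarith) hy0.ne'] at h4
    linarith
  have h4 : y * Real.log N ≤ y * Real.log y + N - y := by
    have := mul_le_mul_of_nonneg_left h3 hy0.le
    have h5 : y * (N / y) = N := by field_simp
    nlinarith
  have h5 : y * Real.log y ≤ N * Real.log y :=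
    mul_le_mul_of_nonneg_right hyN (by linarith)
  nlinarith

/-- A potential `Ψ` that pays for the iterations in which a dual coordinate `ρ` is multiplied by
a factor `α` with `2 ≤ α^q` and `α ≤ N²`. For `q ≥ 2` the powers `ρ^((q-1)/2)` grow geometrically
along these iterations. For `q < 2` the ratio is not bounded away from `1`, but there `log N` is
comparable to the logarithm of the whole range of `ρ`, and `√α` is at most a multiple of
`(N / log N) log α`. -/
lemma exists_potential (hn : 2 ≤ n) (hq : 1 < q) :
    ∃ Ψ : ℝ → ℝ, (∀ ρ, initEntry n q ≤ ρ → 0 ≤ Ψ ρ) ∧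
      (∀ ρ ρ', initEntry n q ≤ ρ → ρ ≤ ρ' → Ψ ρ ≤ Ψ ρ') ∧
      (∀ ρ α, initEntry n q ≤ ρ → 0 ≤ α → 2 ≤ α ^ q → α ≤ iterScale n q ^ 2 →
        α ^ (1 / 2 : ℝ) * (α * ρ) ^ ((q - 1) / 2) ≤ Ψ (α * ρ) - Ψ ρ) ∧
      ∀ ρ, initEntry n q ≤ ρ → ρ ≤ 1 → Ψ ρ ≤ 40 * iterScale n q * ρ ^ ((q - 1) / 2) := by
  set N := iterScale n q with hN
  have hN1 : 1 < N := one_lt_iterScale hn hq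
  set ρ₀ := initEntry n q with hρ₀
  have hρ₀0 : 0 < ρ₀ := initEntry_pos hn hq
  have he : 0 < (q - 1) / 2 := by linarith
  set e := (q - 1) / 2 with he'
  have hα1 : ∀ α : ℝ, 0 ≤ α → 2 ≤ α ^ q → 1 < α := fun α h0 h => by
    by_contra! h1
    have := Real.rpow_le_one h0 h1 (by linarith : 0 ≤ q)
    linarith
  rcases le_or_gt 2 q with h2 | h2
  · refine ⟨fun ρ => 7 * N * ρ ^ e, fun ρ hρ => ?_, fun ρ ρ' hρ hρ' => ?_,
      fun ρ α hρ h0 hα hαN => ?_, fun ρ hρ _ => ?_⟩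
    · have := Real.rpow_nonneg (hρ₀0.le.trans hρ) e
      positivity
    · have := Real.rpow_le_rpow (hρ₀0.le.trans hρ) hρ' he.le
      exact mul_le_mul_of_nonneg_left this (by linarith)
    · have hρ0 : 0 ≤ ρ := hρ₀0.le.trans hρ
      have h3 : 7 / 6 ≤ α ^ e := by
        have h4 : (2 : ℝ) ^ (1 / 4 : ℝ) ≤ α ^ e := by
          have h5 : α ^ e = (α ^ q) ^ (e / q) := by
            rw [← Real.rpow_mul h0]; congr 1; field_simp
          rw [h5]
          refine (Real.rpow_le_rpow_of_exponent_le (by norm_num) ?_).trans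
            (Real.rpow_le_rpow (by norm_num) hα (by positivity))
          rw [he', div_div, div_le_div_iff₀ (by norm_num) (by linarith)]; linarith
        refine le_trans ?_ h4
        calc (7 / 6 : ℝ) = ((7 / 6 : ℝ) ^ (4 : ℝ)) ^ (1 / 4 : ℝ) := by
              rw [← Real.rpow_mul (by norm_num)]; norm_num
          _ ≤ 2 ^ (1 / 4 : ℝ) :=
              Real.rpow_le_rpow (by positivity) (by norm_num) (by norm_num)
      have h6 : α ^ (1 / 2 : ℝ) ≤ N := by
        rw [← Real.sqrt_eq_rpow]; exact Real.sqrt_le_iff.2 ⟨by linarith, hαN⟩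
      dsimp only
      rw [Real.mul_rpow h0 hρ0]
      have h7 := Real.rpow_nonneg hρ0 e
      have h8 : α ^ (1 / 2 : ℝ) * (α ^ e * ρ ^ e) ≤ N * (α ^ e * ρ ^ e) :=
        mul_le_mul_of_nonneg_right h6 (by positivity)
      have h9 : 0 ≤ N * ρ ^ e := by positivity
      nlinarith
    · have := Real.rpow_nonneg (hρ₀0.le.trans hρ) e
      have : 0 ≤ N * ρ ^ e := by positivity
      nlinarith
  · have hlogN : 0 < Real.log N := Real.log_pos hN1
    have hK : 0 < 4 * N / Real.log N := by positivity
    have hlog : ∀ ρ, ρ₀ ≤ ρ → 0 ≤ Real.log (ρ / ρ₀) := fun ρ hρ =>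
      Real.log_nonneg ((one_le_div hρ₀0).2 hρ)
    refine ⟨fun ρ => 4 * N / Real.log N * (ρ ^ e * Real.log (ρ / ρ₀)), fun ρ hρ => ?_,
      fun ρ ρ' hρ hρ' => ?_, fun ρ α hρ h0 hα hαN => ?_, fun ρ hρ hρ1 => ?_⟩
    · have := Real.rpow_nonneg (hρ₀0.le.trans hρ) e
      have := hlog ρ hρ
      positivity
    · refine mul_le_mul_of_nonneg_left ?_ hK.le
      have hρ0 : 0 < ρ := hρ₀0.trans_le hρ
      exact mul_le_mul (Real.rpow_le_rpow hρ0.le hρ' he.le)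
        (Real.log_le_log (by positivity) (by gcongr)) (hlog ρ hρ)
        (Real.rpow_nonneg (hρ0.le.trans hρ') _)
    · have hρ0 : 0 < ρ := hρ₀0.trans_le hρ
      have h1 := hα1 α h0 hα
      have h3 : 2 ≤ α ^ 2 := by
        rw [← Real.rpow_natCast]
        exact hα.trans (Real.rpow_le_rpow_of_exponent_le h1.le (by push_cast; exact h2.le))
      have h4 := rpow_mul_log_le h3 (by linarith) hαN hN1
      have h5 : Real.log (α * ρ / ρ₀) = Real.log α + Real.log (ρ / ρ₀) := by
        rw [mul_div_assoc, Real.log_mul (by linarith) (by positivity)]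
      have h6 : ρ ^ e ≤ (α * ρ) ^ e :=
        Real.rpow_le_rpow hρ0.le (by nlinarith) he.le
      have h7 : 0 ≤ (α * ρ) ^ e := by positivity
      have h8 : α ^ (1 / 2 : ℝ) ≤ 4 * N / Real.log N * Real.log α := by
        rw [div_mul_eq_mul_div, le_div_iff₀ hlogN]; exact h4
      calc α ^ (1 / 2 : ℝ) * (α * ρ) ^ e
          ≤ 4 * N / Real.log N * Real.log α * (α * ρ) ^ e := by gcongr
        _ ≤ 4 * N / Real.log N * Real.log α * (α * ρ) ^ e +
            4 * N / Real.log N * (((α * ρ) ^ e - ρ ^ e) * Real.log (ρ / ρ₀)) := by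
          have := mul_nonneg hK.le (mul_nonneg (sub_nonneg.2 h6) (hlog ρ hρ))
          linarith
        _ = _ := by dsimp only; rw [h5]; ring
    · have hρ0 : 0 < ρ := hρ₀0.trans_le hρ
      have hn0 : (0 : ℝ) < n := by positivity
      have h3 : Real.log (ρ / ρ₀) ≤ 10 * Real.log N := by
        have h4 : 1 ≤ 2 * (n : ℝ) ^ (1 / q) * ρ₀ := by
          rw [mul_assoc, rpow_mul_initEntry hn hq]
          have : 1 / (2 * q) ≤ 1 / 2 := by
            rw [div_le_div_iff₀ (by linarith) (by norm_num)]; linarith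
          linarith
        have h5 : ρ / ρ₀ ≤ 2 * (n : ℝ) ^ (1 / q) := by
          rw [div_le_iff₀ hρ₀0]; linarith
        have h6 := Real.log_le_log (by positivity) h5
        rw [Real.log_mul (by norm_num) (by positivity), Real.log_rpow hn0] at h6
        have h7 : Real.log 2 ≤ Real.log n :=
          Real.log_le_log (by norm_num) (by exact_mod_cast hn)
        have h8 : Real.log n = (2 * q + 1) * Real.log N := by
          rw [hN, log_iterScale hn]; field_simp
        have h9 : 1 / q * Real.log n ≤ Real.log n :=
          mul_le_of_le_one_left (Real.log_nonneg (by exact_mod_cast (by omega : 1 ≤ n)))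
            ((div_le_one (by linarith)).2 hq.le)
        have h10 : (2 * q + 1) * Real.log N ≤ 5 * Real.log N := by gcongr; linarith
        linarith
      have h4 := Real.rpow_nonneg hρ0.le e
      calc 4 * N / Real.log N * (ρ ^ e * Real.log (ρ / ρ₀))
          ≤ 4 * N / Real.log N * (ρ ^ e * (10 * Real.log N)) := by gcongr
        _ = 40 * N * ρ ^ e := by field_simp; norm_num

end

/-! ### One multiplicative update of the dual vector -/

section

variable {n : ℕ} {I : ResidualInput n} {r x : Fin n → ℝ}

lemma one_lt_dualExponent {P : ℝ} (hP : 1 < P) : 1 < dualExponent P := by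
  rw [dualExponent, one_lt_div (by linarith)]; linarith

lemma holderConjugate_dualExponent {P : ℝ} (hP : 1 < P) : (dualExponent P).HolderConjugate P :=
  (Real.HolderConjugate.conjExponent hP).symm

/-- `P (q - 1) = q`. -/
lemma mul_dualExponent_sub_one {P : ℝ} (hP : 1 < P) :
    P * (dualExponent P - 1) = dualExponent P := by
  have : P - 1 ≠ 0 := by linarith
  unfold dualExponent
  field_simp
  ring

lemma lpNorm_rpow_of_nonneg {q : ℝ} (hq : 0 < q) (hr : ∀ i, 0 ≤ r i) :
    lpNorm q r ^ q = ∑ i, r i ^ q := by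
  rw [lpNorm_rpow hq]
  exact Finset.sum_congr rfl fun i _ => by rw [abs_of_nonneg (hr i)]

/-- Either the coordinate is kept, or it is multiplied by `α = γ^(1/q)` with `γ ≥ 2`; both cases
are expressed by the size of `x_i²`. -/
lemma gammaMul_cases (hM : 0 < I.M) {i : Fin n} (hri : 0 < r i) :
    (gammaMul I r x i = 1 ∧ x i ^ 2 * lpNorm (dualExponent I.P) r ^ (dualExponent I.P - 1) ≤
        2 * I.M ^ 2 * r i ^ (dualExponent I.P - 1)) ∨
      (2 ≤ gammaMul I r x i ∧ x i ^ 2 * lpNorm (dualExponent I.P) r ^ (dualExponent I.P - 1) =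
        gammaMul I r x i * I.M ^ 2 * r i ^ (dualExponent I.P - 1)) := by
  have h : 0 < r i ^ (dualExponent I.P - 1) := Real.rpow_pos_of_pos hri _
  unfold gammaMul
  dsimp only
  split_ifs with hv
  · right
    refine ⟨by rwa [le_div_iff₀ (by positivity)], ?_⟩
    field_simp
  · left
    push Not at hv
    exact ⟨rfl, ((div_lt_iff₀ h).1 hv).le⟩

lemma one_le_gammaMul (hM : 0 < I.M) (i : Fin n) : 1 ≤ gammaMul I r x i := by
  unfold gammaMul
  dsimp only
  split_ifs with hv
  · rw [le_div_iff₀ (by positivity)]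
    nlinarith [sq_nonneg I.M]
  · exact le_rfl

lemma one_le_alphaMul (hP : 1 < I.P) (hM : 0 < I.M) (i : Fin n) : 1 ≤ alphaMul I r x i :=
  Real.one_le_rpow (one_le_gammaMul hM i)
    (one_div_nonneg.2 (by linarith [one_lt_dualExponent hP]))

lemma alphaMul_rpow (hP : 1 < I.P) (hM : 0 < I.M) (i : Fin n) :
    alphaMul I r x i ^ dualExponent I.P = gammaMul I r x i := by
  have hq := one_lt_dualExponent hP
  rw [alphaMul, ← Real.rpow_mul (by linarith [one_le_gammaMul (r := r) (x := x) hM i]), one_div,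
    inv_mul_cancel₀ (by linarith), Real.rpow_one]

lemma update_rpow (hP : 1 < I.P) (hM : 0 < I.M) (hr : ∀ i, 0 < r i) (i : Fin n) :
    (alphaMul I r x i * r i) ^ dualExponent I.P = gammaMul I r x i * r i ^ dualExponent I.P := by
  rw [Real.mul_rpow (by linarith [one_le_alphaMul (r := r) (x := x) hP hM i]) (hr i).le,
    alphaMul_rpow hP hM]

lemma le_alphaMul_mul (hP : 1 < I.P) (hM : 0 < I.M) (hr : ∀ i, 0 < r i) (i : Fin n) :
    r i ≤ alphaMul I r x i * r i :=
  le_mul_of_one_le_left (hr i).le (one_le_alphaMul hP hM i)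

/-- `γ (1 - 1/α) ≥ (γ - 1) / q`, which is Bernoulli's inequality for `γ^(1 - 1/q)`. -/
lemma gammaMul_mul_ge (hP : 1 < I.P) (hM : 0 < I.M) (i : Fin n) :
    (gammaMul I r x i - 1) / dualExponent I.P ≤
      gammaMul I r x i * (1 - 1 / alphaMul I r x i) := by
  set q := dualExponent I.P
  have hq : 1 < q := one_lt_dualExponent hP
  have h1 := one_le_gammaMul (r := r) (x := x) hM i
  set γ := gammaMul I r x i with hγ
  have hα : γ * (1 / alphaMul I r x i) = γ ^ (1 - 1 / q) := by
    rw [Real.rpow_sub (by linarith), Real.rpow_one, alphaMul, ← hγ]; ring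
  have h2 : (1 + (γ - 1)) ^ (1 - 1 / q) ≤ 1 + (1 - 1 / q) * (γ - 1) :=
    rpow_one_add_le_one_add_mul_self (by linarith)
      (sub_nonneg.2 ((div_le_one (by linarith)).2 hq.le))
      (sub_le_self _ (one_div_nonneg.2 (by linarith)))
  rw [add_sub_cancel] at h2
  rw [mul_sub, mul_one, hα, div_eq_mul_one_div]
  linarith

/-- The tangent of `t ↦ t^q` at `a` lies below the graph. -/
lemma tangent_le_rpow {q a b : ℝ} (hq : 1 ≤ q) (ha : 0 < a) (hb : 0 ≤ b) :
    q * a ^ (q - 1) * (b - a) ≤ b ^ q - a ^ q := by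
  have h := one_add_mul_self_le_rpow_one_add (s := b / a - 1) (p := q)
    (by linarith [div_nonneg hb ha.le]) hq
  rw [add_sub_cancel, Real.div_rpow hb ha.le, le_div_iff₀ (Real.rpow_pos_of_pos ha _)] at h
  have h2 : a ^ q = a ^ (q - 1) * a := by rw [← Real.rpow_add_one ha.ne']; ring_nf
  have h3 : (1 + q * (b / a - 1)) * a ^ q = a ^ q + q * a ^ (q - 1) * (b - a) := by
    rw [h2]; field_simp
  linarith

/-- The update raises the minimal energy by at least `M²` times the increase of `‖r‖_q`. Here `x`
is the least squares solution for the weights `r + θ`, and `y` is any other feasible vector. -/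
lemma energy_update (hP : 1 < I.P) (hM : 0 < I.M) (hr : ∀ i, 0 < r i) (hθ : ∀ i, 0 ≤ I.θ i)
    (hnorm : 0 < lpNorm (dualExponent I.P) r) {y : Fin n → ℝ}
    (hxy : ∑ i, (r i + I.θ i) * x i * y i = ∑ i, (r i + I.θ i) * x i ^ 2) :
    ∑ i, (r i + I.θ i) * x i ^ 2 +
        I.M ^ 2 * (lpNorm (dualExponent I.P) (fun i => alphaMul I r x i * r i) -
          lpNorm (dualExponent I.P) r) ≤
      ∑ i, (alphaMul I r x i * r i + I.θ i) * y i ^ 2 := by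
  set q := dualExponent I.P with hqdef
  have hq : 1 < q := one_lt_dualExponent hP
  have hα := one_le_alphaMul (r := r) (x := x) hP hM
  set α := alphaMul I r x
  set γ := gammaMul I r x
  set a := lpNorm q r with ha
  have haq : 0 < a ^ (q - 1) := Real.rpow_pos_of_pos hnorm _
  -- the energy gained, coordinate by coordinate
  have h1 : ∀ i, 2 * ((r i + I.θ i) * x i * y i) - (r i + I.θ i) * x i ^ 2
      + r i * x i ^ 2 * (1 - 1 / α i) ≤ (α i * r i + I.θ i) * y i ^ 2 := fun i => by
    have hαi := hα i
    have hri := hr i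
    have hθi := hθ i
    have hw' : 0 < α i * r i + I.θ i := by positivity
    have h2 : 0 ≤ (α i * r i + I.θ i) * (y i - (r i + I.θ i) * x i / (α i * r i + I.θ i)) ^ 2 :=
      by positivity
    have h3 : (α i * r i + I.θ i) * (y i - (r i + I.θ i) * x i / (α i * r i + I.θ i)) ^ 2
        = (α i * r i + I.θ i) * y i ^ 2 - 2 * ((r i + I.θ i) * x i * y i)
          + (r i + I.θ i) ^ 2 / (α i * r i + I.θ i) * x i ^ 2 := by
      field_simp
      ring
    have h4 : (r i + I.θ i) ^ 2 / (α i * r i + I.θ i) ≤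
        (r i + I.θ i) - r i * (1 - 1 / α i) := by
      rw [div_le_iff₀ hw']
      have h5 : ((r i + I.θ i) - r i * (1 - 1 / α i)) * (α i * r i + I.θ i) - (r i + I.θ i) ^ 2
          = I.θ i * r i * (α i - 1) ^ 2 / α i := by
        field_simp
        ring
      have : 0 ≤ I.θ i * r i * (α i - 1) ^ 2 / α i := by positivity
      linarith
    nlinarith [mul_le_mul_of_nonneg_right h4 (sq_nonneg (x i))]
  have h2 : ∀ i, I.M ^ 2 / (q * a ^ (q - 1)) * (γ i * r i ^ q - r i ^ q) ≤
      r i * x i ^ 2 * (1 - 1 / α i) := fun i => by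
    have hri := hr i
    rcases gammaMul_cases (x := x) hM hri with ⟨hγ, -⟩ | ⟨-, hγ⟩
    · have hα1 : α i = 1 := by
        change gammaMul I r x i ^ (1 / q) = 1
        rw [hγ, Real.one_rpow]
      have hγ1 : γ i = 1 := hγ
      rw [hα1, hγ1]
      simp
    · have h3 : x i ^ 2 = γ i * I.M ^ 2 * r i ^ (q - 1) / a ^ (q - 1) := by
        rw [eq_div_iff haq.ne']; exact hγ
      have h4 : r i ^ q = r i ^ (q - 1) * r i := by
        rw [← Real.rpow_add_one hri.ne']; ring_nf
      have h5 := mul_le_mul_of_nonneg_left (gammaMul_mul_ge (r := r) (x := x) hP hM i)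
        (by positivity : 0 ≤ I.M ^ 2 / a ^ (q - 1) * r i ^ q)
      refine le_trans (le_of_eq ?_) (h5.trans (le_of_eq ?_))
      · change _ = I.M ^ 2 / a ^ (q - 1) * r i ^ q * ((γ i - 1) / q)
        field_simp
      · change I.M ^ 2 / a ^ (q - 1) * r i ^ q * (γ i * (1 - 1 / α i)) = _
        rw [h3, h4]
        field_simp
  have h3 : I.M ^ 2 * (lpNorm q (fun i => α i * r i) - a) ≤
      ∑ i, r i * x i ^ 2 * (1 - 1 / α i) := by
    refine le_trans ?_ (Finset.sum_le_sum fun i _ => h2 i)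
    rw [← Finset.mul_sum, Finset.sum_sub_distrib,
      ← lpNorm_rpow_of_nonneg (by linarith) (fun i => (hr i).le),
      Finset.sum_congr rfl fun i _ => (update_rpow (x := x) hP hM hr i).symm,
      ← lpNorm_rpow_of_nonneg (by linarith)
        (fun i => (hr i).le.trans (le_alphaMul_mul (x := x) hP hM hr i)), ← ha]
    have h4 := mul_le_mul_of_nonneg_left (tangent_le_rpow hq.le hnorm
      (lpNorm_nonneg (by linarith : 0 < q) (fun i => α i * r i)))
      (by positivity : 0 ≤ I.M ^ 2 / (q * a ^ (q - 1)))
    refine le_trans (le_of_eq ?_) h4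
    field_simp
  have h4 := Finset.sum_le_sum fun i (_ : i ∈ Finset.univ) => h1 i
  rw [Finset.sum_add_distrib, Finset.sum_sub_distrib, ← Finset.mul_sum, hxy] at h4
  linarith

lemma sum_rpow_le_update (hP : 1 < I.P) (hM : 0 < I.M) (hr : ∀ i, 0 < r i) :
    ∑ i, r i ^ dualExponent I.P ≤ ∑ i, (alphaMul I r x i * r i) ^ dualExponent I.P :=
  Finset.sum_le_sum fun i _ => Real.rpow_le_rpow (hr i).le (le_alphaMul_mul hP hM hr i)
    (by linarith [one_lt_dualExponent hP])

/-- An update with a large multiplier raises `‖r‖_q^q` by at least `1 / (4 N)`. -/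
lemma sum_rpow_update_of_large (hn : 2 ≤ n) (hP : 1 < I.P) (hM : 0 < I.M)
    (hr : ∀ i, initEntry n (dualExponent I.P) ≤ r i)
    (h : ¬ ∀ i, alphaMul I r x i ≤ (n : ℝ) ^ (2 / (2 * dualExponent I.P + 1))) :
    ∑ i, r i ^ dualExponent I.P + 1 / (4 * iterScale n (dualExponent I.P)) ≤
      ∑ i, (alphaMul I r x i * r i) ^ dualExponent I.P := by
  set q := dualExponent I.P with hqdef
  have hq : 1 < q := one_lt_dualExponent hP
  have hr0 : ∀ i, 0 < r i := fun i => (initEntry_pos hn hq).trans_le (hr i)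
  have hN := one_lt_iterScale hn hq
  rw [← iterScale_sq] at h
  have hNn := iterScale_rpow (n := n) hq
  have hhalf := half_le_mul_initEntry_rpow hn hq
  set N := iterScale n q
  push Not at h
  obtain ⟨i, hi⟩ := h
  have hγ : N ^ (2 * q) ≤ gammaMul I r x i := by
    rw [← alphaMul_rpow hP hM, Real.rpow_mul (by linarith), Real.rpow_two]
    exact Real.rpow_le_rpow (by positivity) hi.le (by linarith)
  have hγ2 : 2 ≤ gammaMul I r x i := by
    rcases gammaMul_cases (x := x) hM (hr0 i) with ⟨h1, -⟩ | ⟨h1, -⟩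
    · exfalso
      have : 1 < N ^ (2 * q) := Real.one_lt_rpow hN (by linarith)
      linarith
    · exact h1
  have hri : initEntry n q ^ q ≤ r i ^ q :=
    Real.rpow_le_rpow (initEntry_pos hn hq).le (hr i) (by linarith)
  have h1 : 1 / (4 * N) ≤ gammaMul I r x i * r i ^ q - r i ^ q := by
    have h2 : 0 < r i ^ q := Real.rpow_pos_of_pos (hr0 i) _
    have h3 : 1 / (4 * N) ≤ N ^ (2 * q) * r i ^ q / 2 := by
      rw [div_le_div_iff₀ (by linarith) (by norm_num)]
      have h4 : 1 / 2 ≤ N ^ (2 * q) * N * r i ^ q := by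
        rw [hNn]
        exact hhalf.trans (mul_le_mul_of_nonneg_left hri (Nat.cast_nonneg n))
      linarith
    have h4 := mul_le_mul_of_nonneg_right hγ h2.le
    nlinarith
  have h2 : gammaMul I r x i * r i ^ q - r i ^ q ≤
      ∑ j, ((alphaMul I r x j * r j) ^ q - r j ^ q) := by
    rw [← update_rpow hP hM hr0]
    refine Finset.single_le_sum (f := fun j => (alphaMul I r x j * r j) ^ q - r j ^ q)
      (fun j _ => sub_nonneg.2 ?_) (Finset.mem_univ i)
    exact Real.rpow_le_rpow (hr0 j).le (le_alphaMul_mul hP hM hr0 j) (by linarith)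
  rw [Finset.sum_sub_distrib] at h2
  linarith

lemma lpNorm_ge_of_initEntry_le {q : ℝ} (hn : 2 ≤ n) (hq : 1 < q)
    (hr : ∀ i, initEntry n q ≤ r i) :
    1 - 1 / (2 * q) ≤ lpNorm q r := by
  have h0 := initEntry_pos hn hq
  have h1 : 0 ≤ 1 - 1 / (2 * q) := by
    rw [sub_nonneg, div_le_one (by linarith)]; linarith
  rw [← Real.rpow_le_rpow_iff h1 (lpNorm_nonneg (by linarith) r) (by linarith : 0 < q),
    lpNorm_rpow_of_nonneg (by linarith) (fun i => h0.le.trans (hr i)), ← mul_initEntry_rpow hn hq]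
  calc (n : ℝ) * initEntry n q ^ q = ∑ _i : Fin n, initEntry n q ^ q := by simp
    _ ≤ _ := Finset.sum_le_sum fun i _ => Real.rpow_le_rpow h0.le (hr i) (by linarith)

/-- The size of a recorded iterate: `1.9 M r_i^((q-1)/2)` for a coordinate that is kept, and the
increase of the potential for a coordinate that is updated. -/
lemma abs_le_of_recorded (hn : 2 ≤ n) (hP : 1 < I.P) (hM : 0 < I.M)
    (hr : ∀ i, initEntry n (dualExponent I.P) ≤ r i) {Ψ : ℝ → ℝ}
    (hmono : ∀ ρ ρ', initEntry n (dualExponent I.P) ≤ ρ → ρ ≤ ρ' → Ψ ρ ≤ Ψ ρ')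
    (hΨ : ∀ ρ α, initEntry n (dualExponent I.P) ≤ ρ → 0 ≤ α → 2 ≤ α ^ dualExponent I.P →
      α ≤ iterScale n (dualExponent I.P) ^ 2 →
      α ^ (1 / 2 : ℝ) * (α * ρ) ^ ((dualExponent I.P - 1) / 2) ≤ Ψ (α * ρ) - Ψ ρ)
    {i : Fin n} (hα : alphaMul I r x i ≤ (n : ℝ) ^ (2 / (2 * dualExponent I.P + 1))) :
    |x i| ≤ 1.9 * I.M * ((alphaMul I r x i * r i) ^ ((dualExponent I.P - 1) / 2) +
      (Ψ (alphaMul I r x i * r i) - Ψ (r i))) := by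
  rw [← iterScale_sq] at hα
  have hq : 1 < dualExponent I.P := one_lt_dualExponent hP
  have hr0 : ∀ i, 0 < r i := fun i => (initEntry_pos hn hq).trans_le (hr i)
  have hα1 := one_le_alphaMul (r := r) (x := x) hP hM i
  have hαγ := alphaMul_rpow (r := r) (x := x) hP hM i
  have hcases := gammaMul_cases (x := x) hM (hr0 i)
  have hle := le_alphaMul_mul (x := x) hP hM hr0 i
  set q := dualExponent I.P with hqdef
  set α := alphaMul I r x i
  set γ := gammaMul I r x i
  set e := (q - 1) / 2 with he
  have hri := hr0 i
  have ha : 0.6 ≤ lpNorm q r ^ (q - 1) :=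
    (rpow_sub_one_ge hq).trans (Real.rpow_le_rpow
      (by rw [sub_nonneg, div_le_one (by linarith)]; linarith)
      (lpNorm_ge_of_initEntry_le hn hq hr) (by linarith))
  have hsq : ∀ ρ : ℝ, 0 ≤ ρ → ρ ^ (q - 1) = (ρ ^ e) ^ 2 := fun ρ hρ => by
    rw [← Real.rpow_natCast, ← Real.rpow_mul hρ]
    congr 1
    rw [he]; push_cast; ring
  have hΨ0 : Ψ (r i) ≤ Ψ (α * r i) := hmono _ _ (hr i) hle
  have hpow : r i ^ e ≤ (α * r i) ^ e := Real.rpow_le_rpow hri.le hle (by rw [he]; linarith)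
  have hre : 0 ≤ r i ^ e := Real.rpow_nonneg hri.le _
  rcases hcases with ⟨-, hx⟩ | ⟨hγ, hx⟩
  · have h1 : x i ^ 2 ≤ (1.9 * I.M * r i ^ e) ^ 2 := by
      rw [hsq _ hri.le] at hx
      nlinarith [mul_le_mul_of_nonneg_left ha (sq_nonneg (x i)), sq_nonneg (I.M * r i ^ e)]
    have h2 : |x i| ≤ 1.9 * I.M * r i ^ e := abs_le_of_sq_le_sq h1 (by positivity)
    refine h2.trans (mul_le_mul_of_nonneg_left ?_ (by positivity))
    linarith
  · have h3 : (0 : ℝ) ≤ α := by linarith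
    have h4 : γ * r i ^ (q - 1) = (α ^ (1 / 2 : ℝ) * (α * r i) ^ e) ^ 2 := by
      rw [mul_pow, ← hsq _ (by positivity), Real.mul_rpow h3 hri.le, ← hαγ,
        ← Real.sqrt_eq_rpow, Real.sq_sqrt h3, ← mul_assoc]
      congr 1
      rw [mul_comm, ← Real.rpow_add_one (by linarith)]
      ring_nf
    have h5 : x i ^ 2 ≤ (1.9 * I.M * (α ^ (1 / 2 : ℝ) * (α * r i) ^ e)) ^ 2 := by
      have h6 : γ * I.M ^ 2 * r i ^ (q - 1) = I.M ^ 2 * (γ * r i ^ (q - 1)) := by ring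
      rw [h6, h4] at hx
      nlinarith [mul_le_mul_of_nonneg_left ha (sq_nonneg (x i)),
        sq_nonneg (I.M * (α ^ (1 / 2 : ℝ) * (α * r i) ^ e))]
    have h7 : |x i| ≤ 1.9 * I.M * (α ^ (1 / 2 : ℝ) * (α * r i) ^ e) :=
      abs_le_of_sq_le_sq h5 (by positivity)
    refine h7.trans (mul_le_mul_of_nonneg_left ?_ (by positivity))
    have := hΨ (r i) α (hr i) h3 (by rw [hαγ]; exact hγ) hα
    linarith

/-- If no coordinate is updated, the iterate has norm at most `√2 M`. -/
lemma lpNorm_le_of_alphaMul_eq_one (hP : 1 < I.P) (hM : 0 < I.M) (hr : ∀ i, 0 < r i)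
    (hnorm : 0 < lpNorm (dualExponent I.P) r) (h : ∀ i, alphaMul I r x i = 1) :
    lpNorm (2 * I.P) x ≤ 2 * I.M := by
  set q := dualExponent I.P with hqdef
  have hq : 1 < q := one_lt_dualExponent hP
  set a := lpNorm q r with ha
  have haq : 0 < a ^ (q - 1) := Real.rpow_pos_of_pos hnorm _
  rw [lpNorm_le_iff (by linarith) (by positivity)]
  have h1 : ∀ i, |x i| ^ (2 * I.P) ≤ (4 * I.M ^ 2) ^ I.P * (r i ^ q / a ^ q) := fun i => by
    have hγ : gammaMul I r x i = 1 := by rw [← alphaMul_rpow hP hM, h, Real.one_rpow]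
    have hri := hr i
    have h2 : x i ^ 2 ≤ 4 * I.M ^ 2 * (r i ^ (q - 1) / a ^ (q - 1)) := by
      rcases gammaMul_cases (x := x) hM hri with ⟨-, h2⟩ | ⟨h2, -⟩
      · rw [← mul_div_assoc, le_div_iff₀ haq]
        refine h2.trans (mul_le_mul_of_nonneg_right ?_ (by positivity))
        nlinarith [sq_nonneg I.M]
      · linarith
    rw [Real.rpow_mul (abs_nonneg _), Real.rpow_two, sq_abs]
    refine (Real.rpow_le_rpow (sq_nonneg _) h2 (by linarith)).trans (le_of_eq ?_)
    rw [Real.mul_rpow (by positivity) (by positivity), Real.div_rpow (by positivity) haq.le,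
      ← Real.rpow_mul hri.le, ← Real.rpow_mul hnorm.le, mul_comm (q - 1),
      mul_dualExponent_sub_one hP]
  calc ∑ i, |x i| ^ (2 * I.P) ≤ ∑ i, (4 * I.M ^ 2) ^ I.P * (r i ^ q / a ^ q) :=
        Finset.sum_le_sum fun i _ => h1 i
    _ = (4 * I.M ^ 2) ^ I.P := by
        rw [← Finset.mul_sum, ← Finset.sum_div,
          ← lpNorm_rpow_of_nonneg (by linarith) (fun i => (hr i).le), ← ha,
          div_self (Real.rpow_pos_of_pos hnorm _).ne', mul_one]
    _ = (2 * I.M) ^ (2 * I.P) := by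
        rw [Real.rpow_mul (by positivity), Real.rpow_two]; ring_nf

end

/-! ### The residual solver -/

/-- The value `‖y²‖_P + ⟨θ, y²⟩` of the residual problem is at most `B`. -/
def ResidualValueLE {d n : ℕ} (A : Matrix (Fin d) (Fin n) ℝ) (I : ResidualInput n) (B : ℝ) :
    Prop :=
  ∃ y B₁, Feasible A I.g I.c y ∧ 0 ≤ B₁ ∧ ∑ i, |y i| ^ (2 * I.P) ≤ B₁ ^ I.P ∧
    B₁ + ∑ i, I.θ i * y i ^ 2 ≤ B

/-- The guarantee of the residual solver with threshold `V` on the optimal value: a primal output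
is feasible and of norm at most `2 M`, and if the optimal value is at most `B < V`, then the output
is primal with quadratic part at most `B`. -/
def OutputGood {d n : ℕ} (A : Matrix (Fin d) (Fin n) ℝ) (I : ResidualInput n) (V : ℝ)
    (out : ResidualOutput n) : Prop :=
  (∀ Δ, out = .primal Δ → Feasible A I.g I.c Δ ∧ lpNorm (2 * I.P) Δ ≤ 2 * I.M) ∧
    ∀ B, ResidualValueLE A I B → B < V →
      ∃ Δ, out = .primal Δ ∧ ∑ i, I.θ i * Δ i ^ 2 ≤ B

lemma outputGood_certificate {d n : ℕ} {A : Matrix (Fin d) (Fin n) ℝ} {I : ResidualInput n}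
    {V : ℝ} {r : Fin n → ℝ} (h : ∀ B, ResidualValueLE A I B → V ≤ B) :
    OutputGood A I V (.certificate r) :=
  ⟨fun _ h => by simp at h, fun B hB hV => absurd (h B hB) (not_le.2 hV)⟩

/-- Input data for which the residual solver is analysed. -/
structure ResidualInput.Valid {n : ℕ} (I : ResidualInput n) : Prop where
  M_pos : 0 < I.M
  c_ne : I.c ≠ 0
  θ_nonneg : ∀ i, 0 ≤ I.θ i

section

variable {d n : ℕ} {A : Matrix (Fin d) (Fin n) ℝ} {solve : SystemQuery n → Fin (d + 1) → ℝ}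
  {I : ResidualInput n}

/-- Hölder's inequality: the dual vector `r` bounds the optimal value from below. -/
lemma ResidualValueLE.exists_energy_le {B : ℝ} (hB : ResidualValueLE A I B) (hP : 1 < I.P)
    (r : Fin n → ℝ) :
    ∃ y B₁, Feasible A I.g I.c y ∧ 0 ≤ B₁ ∧ B₁ + ∑ i, I.θ i * y i ^ 2 ≤ B ∧
      ∑ i, (r i + I.θ i) * y i ^ 2 ≤
        lpNorm (dualExponent I.P) r * B₁ + ∑ i, I.θ i * y i ^ 2 := by
  obtain ⟨y, B₁, hy, hB₁, hpow, hsum⟩ := hB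
  refine ⟨y, B₁, hy, hB₁, hsum, ?_⟩
  have h := Real.inner_le_Lp_mul_Lq Finset.univ r (fun i => y i ^ 2)
    (holderConjugate_dualExponent hP)
  rw [← lpNorm_eq (by linarith [one_lt_dualExponent hP])] at h
  have h1 : ∑ i, |y i ^ 2| ^ I.P = ∑ i, |y i| ^ (2 * I.P) :=
    Finset.sum_congr rfl fun i _ => by
      rw [abs_pow, ← Real.rpow_two, ← Real.rpow_mul (abs_nonneg _)]
  have h2 : (∑ i, |y i ^ 2| ^ I.P) ^ (1 / I.P) ≤ B₁ := by
    rw [h1]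
    refine (Real.rpow_le_rpow (sum_abs_rpow_nonneg _ _) hpow (by positivity)).trans (le_of_eq ?_)
    rw [← Real.rpow_mul hB₁, mul_one_div_cancel (by linarith), Real.rpow_one]
  have h3 := mul_le_mul_of_nonneg_left h2
    (lpNorm_nonneg (by linarith [one_lt_dualExponent hP] : 0 < dualExponent I.P) r)
  simp only [add_mul, Finset.sum_add_distrib]
  linarith

lemma Feasible.add {g x y : Fin n → ℝ} {c c' : ℝ} (hx : Feasible A g c x)
    (hy : Feasible A g c' y) : Feasible A g (c + c') (x + y) :=
  ⟨by rw [mulVec_add, hx.1, hy.1, add_zero], by rw [dotProduct_add, hx.2, hy.2]⟩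

lemma Feasible.smul {g x : Fin n → ℝ} {c : ℝ} (a : ℝ) (hx : Feasible A g c x) :
    Feasible A g (a * c) (a • x) :=
  ⟨by rw [mulVec_smul, hx.1, smul_zero], by rw [dotProduct_smul, hx.2, smul_eq_mul]⟩

/-- The triangle inequality for the seminorm `⟨θ, x²⟩^(1/2)`, for sums of `k` and `1` terms of
squared size at most `B`. -/
lemma sum_mul_add_sq_le {θ s x : Fin n → ℝ} {k B : ℝ} (hθ : ∀ i, 0 ≤ θ i) (hk : 0 ≤ k)
    (hs : ∑ i, θ i * s i ^ 2 ≤ k ^ 2 * B) (hx : ∑ i, θ i * x i ^ 2 ≤ B) :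
    ∑ i, θ i * (s i + x i) ^ 2 ≤ (k + 1) ^ 2 * B := by
  have hB : 0 ≤ B := (Finset.sum_nonneg fun i _ => mul_nonneg (hθ i) (sq_nonneg _)).trans hx
  have hc : ∑ i, θ i * s i * x i ≤ k * B := by
    refine abs_le_of_sq_le_sq' ?_ (by positivity) |>.2
    have h := Finset.sum_mul_sq_le_sq_mul_sq Finset.univ (fun i => √(θ i) * s i)
      (fun i => √(θ i) * x i)
    have h1 : ∀ u v : Fin n → ℝ, ∑ i, √(θ i) * u i * (√(θ i) * v i) = ∑ i, θ i * u i * v i :=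
      fun u v => Finset.sum_congr rfl fun i _ => by
        nth_rw 3 [← Real.mul_self_sqrt (hθ i)]; ring
    have h2 : ∀ u : Fin n → ℝ, ∑ i, (√(θ i) * u i) ^ 2 = ∑ i, θ i * u i ^ 2 := fun u =>
      Finset.sum_congr rfl fun i _ => by rw [mul_pow, Real.sq_sqrt (hθ i)]
    rw [h1, h2, h2] at h
    refine h.trans ((mul_le_mul hs hx
      (Finset.sum_nonneg fun i _ => mul_nonneg (hθ i) (sq_nonneg _)) (by positivity)).trans ?_)
    exact le_of_eq (by ring)
  have : ∑ i, θ i * (s i + x i) ^ 2 =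
      ∑ i, θ i * s i ^ 2 + 2 * ∑ i, θ i * s i * x i + ∑ i, θ i * x i ^ 2 := by
    rw [Finset.mul_sum, ← Finset.sum_add_distrib, ← Finset.sum_add_distrib]
    exact Finset.sum_congr rfl fun i _ => by ring
  rw [this]
  linarith

lemma lpNorm_div_le_iff {p B k : ℝ} (hp : 0 < p) (hB : 0 ≤ B) (hk : 0 < k) (s : Fin n → ℝ) :
    lpNorm p (fun i => s i / k) ≤ B ↔ lpNorm p s ≤ B * k := by
  rw [lpNorm_le_iff hp hB, lpNorm_le_iff hp (by positivity), Real.mul_rpow hB hk.le]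
  have h : ∑ i, |s i / k| ^ p = (∑ i, |s i| ^ p) / k ^ p := by
    rw [Finset.sum_div]
    exact Finset.sum_congr rfl fun i _ => by
      rw [abs_div, abs_of_pos hk, Real.div_rpow (abs_nonneg _) hk.le]
  rw [h, div_le_iff₀ (Real.rpow_pos_of_pos hk _)]

/-- The invariant of the loop after `t` iterations. The dual vector has gained energy in
proportion to its norm; the recorded iterates are feasible and of small quadratic part; the
number of recorded iterations is bounded through the potential `Ψ`, that of the others through
`‖r‖_q^q`. -/
structure LoopInv (A : Matrix (Fin d) (Fin n) ℝ) (I : ResidualInput n) (Ψ : ℝ → ℝ)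
    (st : ResidualState n) (t : ℕ) : Prop where
  r_ge : ∀ i, initEntry n (dualExponent I.P) ≤ st.r i
  s_le : ∀ i, |st.s i| ≤
    1.9 * I.M * (st.k * st.r i ^ ((dualExponent I.P - 1) / 2) + Ψ (st.r i))
  t_le : (t : ℝ) ≤
    st.k + 4 * iterScale n (dualExponent I.P) * ∑ i, st.r i ^ dualExponent I.P
  k_or : st.k = 0 ∨ 2 * I.M * st.k < lpNorm (2 * I.P) st.s
  feas : Feasible A I.g (st.k * I.c) st.s
  energy : ∀ y, Feasible A I.g I.c y →
    I.M ^ 2 * (lpNorm (dualExponent I.P) st.r - (1 - 1 / (2 * dualExponent I.P))) ≤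
      ∑ i, (st.r i + I.θ i) * y i ^ 2
  quad : ∀ B, ResidualValueLE A I B → ∑ i, I.θ i * st.s i ^ 2 ≤ st.k ^ 2 * B

/-- The properties of `Ψ` provided by `exists_potential`. -/
structure IsPotential (n : ℕ) (q : ℝ) (Ψ : ℝ → ℝ) : Prop where
  nonneg : ∀ ρ, initEntry n q ≤ ρ → 0 ≤ Ψ ρ
  mono : ∀ ρ ρ', initEntry n q ≤ ρ → ρ ≤ ρ' → Ψ ρ ≤ Ψ ρ'
  gain : ∀ ρ α, initEntry n q ≤ ρ → 0 ≤ α → 2 ≤ α ^ q → α ≤ iterScale n q ^ 2 →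
    α ^ (1 / 2 : ℝ) * (α * ρ) ^ ((q - 1) / 2) ≤ Ψ (α * ρ) - Ψ ρ
  le : ∀ ρ, initEntry n q ≤ ρ → ρ ≤ 1 → Ψ ρ ≤ 40 * iterScale n q * ρ ^ ((q - 1) / 2)

variable {Ψ : ℝ → ℝ} {st st' : ResidualState n} {t : ℕ}

lemma lpNorm_const_initEntry (hn : 2 ≤ n) {q : ℝ} (hq : 1 < q) :
    lpNorm q (fun _ : Fin n => initEntry n q) = 1 - 1 / (2 * q) := by
  have h1 : 0 ≤ 1 - 1 / (2 * q) := by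
    rw [sub_nonneg, div_le_one (by linarith)]; linarith
  refine le_antisymm ?_ (lpNorm_ge_of_initEntry_le hn hq fun _ => le_rfl)
  rw [lpNorm_le_iff (by linarith) h1, ← mul_initEntry_rpow hn hq,
    abs_of_pos (initEntry_pos hn hq)]
  simp

lemma loopInv_initState (hn : 2 ≤ n) (hP : 1 < I.P) (hI : I.Valid)
    (hΨ : IsPotential n (dualExponent I.P) Ψ) : LoopInv A I Ψ (initState n I.P) 0 := by
  have hq := one_lt_dualExponent hP
  have hr : (initState n I.P).r = fun _ => initEntry n (dualExponent I.P) := rfl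
  have hs : (initState n I.P).s = 0 := rfl
  have hk : (initState n I.P).k = 0 := rfl
  have h0 := initEntry_pos hn hq
  have hN := one_lt_iterScale hn hq
  have hM := hI.M_pos
  refine ⟨fun i => le_rfl, fun i => ?_, ?_, Or.inl hk, ?_, fun y _ => ?_, fun B _ => ?_⟩
  · rw [hs, hk, hr]
    have := hΨ.nonneg _ le_rfl
    simp only [Pi.zero_apply, abs_zero, CharP.cast_eq_zero, zero_mul, zero_add]
    positivity
  · rw [hr, hk]
    have : 0 < initEntry n (dualExponent I.P) ^ dualExponent I.P := Real.rpow_pos_of_pos h0 _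
    simp only [CharP.cast_eq_zero, zero_add]
    positivity
  · rw [hs, hk]
    exact ⟨mulVec_zero _, by simp⟩
  · rw [hr, lpNorm_const_initEntry hn hq, sub_self, mul_zero]
    exact Finset.sum_nonneg fun i _ =>
      mul_nonneg (add_nonneg h0.le (hI.θ_nonneg i)) (sq_nonneg _)
  · rw [hs, hk]
    simp

lemma LoopInv.r_pos (h : LoopInv A I Ψ st t) (hn : 2 ≤ n) (hP : 1 < I.P) (i : Fin n) :
    0 < st.r i :=
  (initEntry_pos hn (one_lt_dualExponent hP)).trans_le (h.r_ge i)

lemma LoopInv.lpNorm_pos (h : LoopInv A I Ψ st t) (hn : 2 ≤ n) (hP : 1 < I.P) :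
    0 < lpNorm (dualExponent I.P) st.r := by
  have hq := one_lt_dualExponent hP
  refine lt_of_lt_of_le ?_ (lpNorm_ge_of_initEntry_le hn hq h.r_ge)
  rw [sub_pos, div_lt_one (by linarith)]; linarith

/-- The number of iterations, while the loop condition holds. -/
lemma LoopInv.le_of_sum_le_one (h : LoopInv A I Ψ st t) (hn : 2 ≤ n) (hP : 1 < I.P)
    (hI : I.Valid) (hΨ : IsPotential n (dualExponent I.P) Ψ)
    (hsum : ∑ i, st.r i ^ dualExponent I.P ≤ 1) :
    (t : ℝ) ≤ 764 * iterScale n (dualExponent I.P) := by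
  have ht := h.t_le
  have hr := h.r_pos hn hP
  have hq := one_lt_dualExponent hP
  have hPq := mul_dualExponent_sub_one hP
  have hM := hI.M_pos
  have hN := one_lt_iterScale hn hq
  set q := dualExponent I.P
  set N := iterScale n q
  have h1 : 4 * N * ∑ i, st.r i ^ q ≤ 4 * N := by nlinarith
  suffices h2 : (st.k : ℝ) ≤ 760 * N by linarith
  rcases h.k_or with hk | hk
  · rw [hk]; push_cast; linarith
  have hk0 : (0 : ℝ) ≤ st.k := Nat.cast_nonneg _
  have h3 : lpNorm (2 * I.P) st.s ≤ 1.9 * I.M * (st.k + 40 * N) := by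
    rw [lpNorm_le_iff (by linarith) (by positivity)]
    have h4 : ∀ i, |st.s i| ^ (2 * I.P) ≤
        (1.9 * I.M * (st.k + 40 * N)) ^ (2 * I.P) * st.r i ^ q := fun i => by
      have hri := hr i
      have hr1 : st.r i ≤ 1 := by
        by_contra! hc
        have h5 := Real.one_lt_rpow hc (by linarith : 0 < q)
        have h6 := Finset.single_le_sum (f := fun i => st.r i ^ q)
          (fun j _ => Real.rpow_nonneg (hr j).le _) (Finset.mem_univ i)
        linarith
      have h5 : |st.s i| ≤ 1.9 * I.M * (st.k + 40 * N) * st.r i ^ ((q - 1) / 2) := by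
        refine (h.s_le i).trans ?_
        rw [mul_assoc (1.9 * I.M)]
        refine mul_le_mul_of_nonneg_left ?_ (by positivity)
        have := hΨ.le _ (h.r_ge i) hr1
        rw [add_mul]
        linarith
      refine (Real.rpow_le_rpow (abs_nonneg _) h5 (by linarith)).trans (le_of_eq ?_)
      rw [Real.mul_rpow (by positivity) (by positivity), ← Real.rpow_mul hri.le]
      congr 2
      linarith
    refine (Finset.sum_le_sum fun i _ => h4 i).trans ?_
    rw [← Finset.mul_sum]
    exact mul_le_of_le_one_right (by positivity) hsum
  have h4 : I.M * (2 * st.k) ≤ I.M * (1.9 * (st.k + 40 * N)) := by linarith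
  have h5 := le_of_mul_le_mul_left h4 hM
  linarith

/-- The effect of one pass through the body of the loop. -/
lemma residualBody_cases (A : Matrix (Fin d) (Fin n) ℝ) (solve : SystemQuery n → Fin (d + 1) → ℝ)
    (I : ResidualInput n) (st : ResidualState n) :
    (leastSquares A solve I.g I.c (fun i => st.r i + I.θ i) = none ∧
        residualBody A solve I st = .inr (.certificate st.r)) ∨
      ∃ x, leastSquares A solve I.g I.c (fun i => st.r i + I.θ i) = some x ∧
        (((∀ i, alphaMul I st.r x i = 1) ∧ residualBody A solve I st = .inr (.primal x)) ∨
          ∃ s' k', recordIterate I st x = (s', k') ∧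
            ((0 < k' ∧ lpNorm (2 * I.P) (fun i => s' i / k') ≤ 2 * I.M ∧
                residualBody A solve I st = .inr (.primal (fun i => s' i / k'))) ∨
              (¬ (0 < k' ∧ lpNorm (2 * I.P) (fun i => s' i / k') ≤ 2 * I.M) ∧
                residualBody A solve I st =
                  .inl ⟨fun i => alphaMul I st.r x i * st.r i, s', k'⟩))) := by
  unfold residualBody
  cases hx : leastSquares A solve I.g I.c (fun i => st.r i + I.θ i) with
  | none => exact Or.inl ⟨rfl, rfl⟩
  | some x =>
    refine Or.inr ⟨x, rfl, ?_⟩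
    by_cases h1 : ∀ i, alphaMul I st.r x i = 1
    · exact Or.inl ⟨h1, by simp only [if_pos h1]⟩
    · refine Or.inr ⟨(recordIterate I st x).1, (recordIterate I st x).2, rfl, ?_⟩
      by_cases h2 : 0 < (recordIterate I st x).2 ∧ lpNorm (2 * I.P)
          (fun i => (recordIterate I st x).1 i / (recordIterate I st x).2) ≤ 2 * I.M
      · exact Or.inl ⟨h2.1, h2.2, by simp only [if_neg h1, if_pos h2]⟩
      · exact Or.inr ⟨h2, by simp only [if_neg h1, if_neg h2]⟩

/-- The quadratic part of a least squares iterate, while the loop condition holds. -/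
lemma LoopInv.sum_theta_sq_le (h : LoopInv A I Ψ st t) (hn : 2 ≤ n) (hP : 1 < I.P)
    (hI : I.Valid) (hsum : ∑ i, st.r i ^ dualExponent I.P ≤ 1) {x : Fin n → ℝ}
    (hx : leastSquares A solve I.g I.c (fun i => st.r i + I.θ i) = some x) {B : ℝ}
    (hB : ResidualValueLE A I B) : ∑ i, I.θ i * x i ^ 2 ≤ B := by
  have hr := h.r_pos hn hP
  have hq := one_lt_dualExponent hP
  have hw : ∀ i, 0 < st.r i + I.θ i := fun i => add_pos_of_pos_of_nonneg (hr i) (hI.θ_nonneg i)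
  obtain ⟨y, B₁, hy, hB₁, hBle, hE⟩ := hB.exists_energy_le hP st.r
  have h1 := sum_weight_sq_le (fun i => (hw i).le) ((leastSquares_spec hw hx).2 y hy)
  have h2 : lpNorm (dualExponent I.P) st.r ≤ 1 := by
    rw [lpNorm_le_iff (by linarith) zero_le_one, Real.one_rpow]
    refine le_trans (le_of_eq (Finset.sum_congr rfl fun i _ => ?_)) hsum
    rw [abs_of_pos (hr i)]
  have h3 : ∑ i, I.θ i * x i ^ 2 ≤ ∑ i, (st.r i + I.θ i) * x i ^ 2 :=
    Finset.sum_le_sum fun i _ =>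
      mul_le_mul_of_nonneg_right (by linarith [hr i]) (sq_nonneg _)
  nlinarith

/-- What recording the least squares iterate `x` preserves. -/
lemma LoopInv.recordIterate_spec (h : LoopInv A I Ψ st t) (hn : 2 ≤ n) (hP : 1 < I.P)
    (hI : I.Valid) (hsum : ∑ i, st.r i ^ dualExponent I.P ≤ 1) {x : Fin n → ℝ}
    (hx : leastSquares A solve I.g I.c (fun i => st.r i + I.θ i) = some x)
    {s' : Fin n → ℝ} {k' : ℕ} (hrec : recordIterate I st x = (s', k')) :
    Feasible A I.g (k' * I.c) s' ∧
      ∀ B, ResidualValueLE A I B → ∑ i, I.θ i * s' i ^ 2 ≤ k' ^ 2 * B := by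
  have hw : ∀ i, 0 < st.r i + I.θ i := fun i =>
    add_pos_of_pos_of_nonneg (h.r_pos hn hP i) (hI.θ_nonneg i)
  unfold recordIterate at hrec
  split_ifs at hrec
  · obtain ⟨rfl, rfl⟩ := Prod.mk.inj hrec
    refine ⟨?_, fun B hB => ?_⟩
    · have := h.feas.add (leastSquares_spec hw hx).1
      convert this using 1
      push_cast; ring
    · have := sum_mul_add_sq_le hI.θ_nonneg (Nat.cast_nonneg st.k) (h.quad B hB)
        (h.sum_theta_sq_le hn hP hI hsum hx hB)
      push_cast
      exact this
  · obtain ⟨rfl, rfl⟩ := Prod.mk.inj hrec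
    exact ⟨h.feas, h.quad⟩

lemma LoopInv.next (h : LoopInv A I Ψ st t) (hn : 2 ≤ n) (hP : 1 < I.P)
    (hI : I.Valid) (hΨ : IsPotential n (dualExponent I.P) Ψ)
    (hsum : ∑ i, st.r i ^ dualExponent I.P ≤ 1)
    (hbody : residualBody A solve I st = .inl st') : LoopInv A I Ψ st' (t + 1) := by
  have hr := h.r_pos hn hP
  have hq := one_lt_dualExponent hP
  have hM := hI.M_pos
  have hN := one_lt_iterScale hn hq
  have hw : ∀ i, 0 < st.r i + I.θ i := fun i => add_pos_of_pos_of_nonneg (hr i) (hI.θ_nonneg i)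
  rcases residualBody_cases A solve I st with ⟨-, hb⟩ | ⟨x, hx, ⟨-, hb⟩ | ⟨s', k', hrec,
    ⟨-, -, hb⟩ | ⟨hcond, hb⟩⟩⟩
  · rw [hb] at hbody; simp at hbody
  · rw [hb] at hbody; simp at hbody
  · rw [hb] at hbody; simp at hbody
  rw [hb] at hbody
  obtain rfl := Sum.inl.inj hbody
  obtain ⟨hfeas, hquad⟩ := h.recordIterate_spec hn hP hI hsum hx hrec
  obtain ⟨hxf, horth⟩ := leastSquares_spec hw hx
  have hle := le_alphaMul_mul (x := x) hP hM hr
  have hpow : ∀ i, st.r i ^ ((dualExponent I.P - 1) / 2) ≤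
      (alphaMul I st.r x i * st.r i) ^ ((dualExponent I.P - 1) / 2) := fun i =>
    Real.rpow_le_rpow (hr i).le (hle i) (by linarith)
  have hΨle : ∀ i, Ψ (st.r i) ≤ Ψ (alphaMul I st.r x i * st.r i) := fun i =>
    hΨ.mono _ _ (h.r_ge i) (hle i)
  refine ⟨fun i => (h.r_ge i).trans (hle i), fun i => ?_, ?_, ?_, hfeas, fun y hy => ?_, hquad⟩
  · dsimp only
    have hs := h.s_le i
    have hk0 : (0 : ℝ) ≤ st.k := Nat.cast_nonneg _
    have h1 := mul_le_mul_of_nonneg_left (hpow i) hk0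
    unfold recordIterate at hrec
    split_ifs at hrec with hα
    · obtain ⟨rfl, rfl⟩ := Prod.mk.inj hrec
      have h2 := abs_le_of_recorded hn hP hM h.r_ge hΨ.mono hΨ.gain (hα i)
      refine (abs_add_le _ _).trans ((add_le_add hs h2).trans ?_)
      rw [← mul_add]
      refine mul_le_mul_of_nonneg_left ?_ (by positivity)
      push_cast
      linarith
    · obtain ⟨rfl, rfl⟩ := Prod.mk.inj hrec
      refine hs.trans (mul_le_mul_of_nonneg_left ?_ (by positivity))
      linarith [hΨle i]
  · dsimp only
    have ht := h.t_le
    unfold recordIterate at hrec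
    split_ifs at hrec with hα
    · obtain ⟨rfl, rfl⟩ := Prod.mk.inj hrec
      have h1 := mul_le_mul_of_nonneg_left (sum_rpow_le_update (x := x) hP hM hr)
        (by linarith : 0 ≤ 4 * iterScale n (dualExponent I.P))
      push_cast
      linarith
    · obtain ⟨rfl, rfl⟩ := Prod.mk.inj hrec
      have h1 := mul_le_mul_of_nonneg_left (sum_rpow_update_of_large hn hP hM h.r_ge hα)
        (by linarith : 0 ≤ 4 * iterScale n (dualExponent I.P))
      rw [mul_add, mul_one_div_cancel (by linarith)] at h1
      push_cast
      linarith
  · dsimp only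
    rcases Nat.eq_zero_or_pos k' with hk | hk
    · exact Or.inl hk
    · right
      by_contra! hc
      refine hcond ⟨hk, ?_⟩
      exact (lpNorm_div_le_iff (by linarith) (by positivity) (by exact_mod_cast hk) s').2 hc
  · have h1 := energy_update hP hM hr hI.θ_nonneg (h.lpNorm_pos hn hP) (horth y hy)
    have h2 := h.energy x hxf
    dsimp only
    linarith

lemma LoopInv.outputGood_of_exit (h : LoopInv A I Ψ st t) (hn : 2 ≤ n) (hP : 1 < I.P)
    (hI : I.Valid) (hsum : 1 < ∑ i, st.r i ^ dualExponent I.P) :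
    OutputGood A I (I.M ^ 2 / (2 * dualExponent I.P)) (.certificate st.r) := by
  refine outputGood_certificate fun B hB => ?_
  have hr := h.r_pos hn hP
  have hq := one_lt_dualExponent hP
  obtain ⟨y, B₁, hy, hB₁, hBle, hE⟩ := hB.exists_energy_le hP st.r
  have h1 := h.energy y hy
  have h2 : 1 < lpNorm (dualExponent I.P) st.r := by
    by_contra! hc
    rw [lpNorm_le_iff (by linarith) zero_le_one, Real.one_rpow] at hc
    refine absurd (hsum.trans_le ?_) (lt_irrefl _)
    refine le_trans (le_of_eq (Finset.sum_congr rfl fun i _ => ?_)) hc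
    rw [abs_of_pos (hr i)]
  set a := lpNorm (dualExponent I.P) st.r
  have hθ : 0 ≤ ∑ i, I.θ i * y i ^ 2 :=
    Finset.sum_nonneg fun i _ => mul_nonneg (hI.θ_nonneg i) (sq_nonneg _)
  -- dividing the energy bound by `‖r‖_q > 1` keeps the gain `1/(2q)`
  have h3 : I.M ^ 2 * (a * (1 / (2 * dualExponent I.P))) ≤ a * B := by
    have h4 : 0 ≤ (a - 1) * (1 - 1 / (2 * dualExponent I.P)) :=
      mul_nonneg (by linarith) (by rw [sub_nonneg, div_le_one (by linarith)]; linarith)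
    have h5 := mul_nonneg (sq_nonneg I.M) h4
    nlinarith
  have h6 : a * (I.M ^ 2 / (2 * dualExponent I.P)) ≤ a * B := by
    refine le_trans (le_of_eq ?_) h3
    ring
  exact le_of_mul_le_mul_left h6 (by linarith)

lemma LoopInv.outputGood_of_ret (h : LoopInv A I Ψ st t) (hsolve : SolvesSystems A solve)
    (hn : 2 ≤ n) (hP : 1 < I.P) (hI : I.Valid) (hsum : ∑ i, st.r i ^ dualExponent I.P ≤ 1)
    {out : ResidualOutput n} (hbody : residualBody A solve I st = .inr out) {V : ℝ} :
    OutputGood A I V out := by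
  have hr := h.r_pos hn hP
  have hM := hI.M_pos
  have hw : ∀ i, 0 < st.r i + I.θ i := fun i => add_pos_of_pos_of_nonneg (hr i) (hI.θ_nonneg i)
  rcases residualBody_cases A solve I st with ⟨hx, hb⟩ | ⟨x, hx, ⟨hα, hb⟩ | ⟨s', k', hrec,
    ⟨hk, hnorm, hb⟩ | ⟨-, hb⟩⟩⟩
  · rw [hb] at hbody
    obtain rfl := Sum.inr.inj hbody
    refine outputGood_certificate fun B ⟨y, _, hy, _⟩ => ?_
    exact absurd hy (not_feasible_of_leastSquares_eq_none hsolve hI.c_ne hw hx y)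
  · rw [hb] at hbody
    obtain rfl := Sum.inr.inj hbody
    refine ⟨fun Δ hΔ => ?_, fun B hB _ => ⟨x, rfl, h.sum_theta_sq_le hn hP hI hsum hx hB⟩⟩
    obtain rfl := ResidualOutput.primal.inj hΔ
    exact ⟨(leastSquares_spec hw hx).1,
      lpNorm_le_of_alphaMul_eq_one hP hM hr (h.lpNorm_pos hn hP) hα⟩
  · rw [hb] at hbody
    obtain rfl := Sum.inr.inj hbody
    obtain ⟨hfeas, hquad⟩ := h.recordIterate_spec hn hP hI hsum hx hrec
    have hk0 : (0 : ℝ) < k' := by exact_mod_cast hk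
    refine ⟨fun Δ hΔ => ?_, fun B hB _ => ⟨_, rfl, ?_⟩⟩
    · obtain rfl := ResidualOutput.primal.inj hΔ
      refine ⟨?_, hnorm⟩
      have h1 := hfeas.smul (k' : ℝ)⁻¹
      rw [inv_mul_cancel_left₀ hk0.ne'] at h1
      convert h1 using 1
      ext i
      simp [div_eq_inv_mul]
    · have h1 : ∑ i, I.θ i * (s' i / k') ^ 2 = (∑ i, I.θ i * s' i ^ 2) / k' ^ 2 := by
        rw [Finset.sum_div]
        exact Finset.sum_congr rfl fun i _ => by rw [div_pow, mul_div_assoc]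
      rw [h1, div_le_iff₀ (by positivity), mul_comm]
      exact hquad B hB
  · rw [hb] at hbody; simp at hbody

lemma residualQuery_wellFormed (hI : I.Valid) {r : Fin n → ℝ} (hr : ∀ i, 0 ≤ r i) :
    (residualQuery I r).WellFormed :=
  lsQuery_wellFormed hI.c_ne fun i => add_nonneg (hr i) (hI.θ_nonneg i)

lemma ResidualLoop.spec (hsolve : SolvesSystems A solve) (hn : 2 ≤ n) (hP : 1 < I.P)
    (hI : I.Valid) (hΨ : IsPotential n (dualExponent I.P) Ψ) {L : List (SystemQuery n)}
    {out : ResidualOutput n} (hloop : ResidualLoop A solve I st L out) :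
    ∀ t, LoopInv A I Ψ st t → (t : ℝ) ≤ 764 * iterScale n (dualExponent I.P) + 1 →
      OutputGood A I (I.M ^ 2 / (2 * dualExponent I.P)) out ∧ (∀ Q ∈ L, Q.WellFormed) ∧
        (L.length : ℝ) ≤ 764 * iterScale n (dualExponent I.P) + 1 - t := by
  induction hloop with
  | exit st hst =>
    intro t h ht
    exact ⟨h.outputGood_of_exit hn hP hI hst, by simp, by simpa using ht⟩
  | ret st out hst hbody =>
    intro t h _
    have h1 := h.le_of_sum_le_one hn hP hI hΨ hst
    refine ⟨h.outputGood_of_ret hsolve hn hP hI hst hbody, ?_, ?_⟩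
    · intro Q hQ
      rw [List.mem_singleton] at hQ
      rw [hQ]
      exact residualQuery_wellFormed hI fun i => (h.r_pos hn hP i).le
    · rw [List.length_singleton]; push_cast; linarith
  | next st st' L out hst hbody _ ih =>
    intro t h _
    have h1 := h.le_of_sum_le_one hn hP hI hΨ hst
    obtain ⟨h2, h3, h4⟩ := ih (t + 1) (h.next hn hP hI hΨ hst hbody) (by push_cast; linarith)
    refine ⟨h2, ?_, ?_⟩
    · intro Q hQ
      rcases List.mem_cons.1 hQ with rfl | hQ
      · exact residualQuery_wellFormed hI fun i => (h.r_pos hn hP i).le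
      · exact h3 Q hQ
    · rw [List.length_cons]; push_cast at h4 ⊢; linarith

lemma exists_residualLoop (hn : 2 ≤ n) (hP : 1 < I.P) (hI : I.Valid)
    (hΨ : IsPotential n (dualExponent I.P) Ψ) (m : ℕ) :
    ∀ (st : ResidualState n) (t : ℕ), LoopInv A I Ψ st t →
      764 * iterScale n (dualExponent I.P) < t + m →
      ∃ L out, ResidualLoop A solve I st L out := by
  induction m with
  | zero =>
    intro st t h ht
    refine ⟨_, _, .exit st ?_⟩
    by_contra! hc
    have := h.le_of_sum_le_one hn hP hI hΨ hc
    push_cast at ht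
    linarith
  | succ m ih =>
    intro st t h ht
    rcases lt_or_ge 1 (∑ i, st.r i ^ dualExponent I.P) with hst | hst
    · exact ⟨_, _, .exit st hst⟩
    · cases hbody : residualBody A solve I st with
      | inr out => exact ⟨_, _, .ret st out hst hbody⟩
      | inl st' =>
        obtain ⟨L, out, hL⟩ := ih st' (t + 1) (h.next hn hP hI hΨ hst hbody)
          (by push_cast at ht ⊢; linarith)
        exact ⟨_, _, .next st st' L out hst hbody hL⟩

lemma one_lt_of_not_smallExponent (hn : 2 ≤ n) {P : ℝ} (h : ¬ SmallExponent n P) : 1 < P := by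
  rw [SmallExponent, not_le] at h
  have h1 : 1 ≤ Real.logb 2 n := by
    rw [Real.le_logb_iff_rpow_le (by norm_num) (by positivity)]
    exact_mod_cast hn
  by_contra! hP
  have := mul_le_mul_of_nonneg_right hP (by linarith : 0 ≤ Real.logb 2 n - 1)
  linarith

/-- In the regime of small `P`, the initial dual vector is bounded below by `1/2`. -/
lemma half_le_initSmall (hn : 2 ≤ n) {P : ℝ} (hP : 1 ≤ P) (h : SmallExponent n P) :
    1 / 2 ≤ (n : ℝ) ^ (-((P - 1) / P)) := by
  have hn0 : (0 : ℝ) < n := by positivity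
  have hnl : (n : ℝ) = 2 ^ Real.logb 2 n := by
    rw [Real.rpow_logb (by norm_num) (by norm_num) hn0]
  rw [SmallExponent] at h
  have h1 : (n : ℝ) ^ ((P - 1) / P) ≤ 2 := by
    nth_rw 1 [hnl]
    rw [← Real.rpow_mul (by norm_num)]
    nth_rw 3 [← Real.rpow_one 2]
    refine Real.rpow_le_rpow_of_exponent_le (by norm_num) ?_
    rw [mul_div_assoc', div_le_one (by linarith)]
    linarith
  rw [Real.rpow_neg hn0.le, one_div]
  exact inv_anti₀ (by positivity) h1

/-- In the regime of small `P`, `⟨r, y²⟩` is at most `‖y²‖_P`. -/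
lemma initSmall_mul_sum_sq_le (hn : 2 ≤ n) {P B₁ : ℝ} (hP : 1 ≤ P) (hB₁ : 0 ≤ B₁)
    {y : Fin n → ℝ} (h : ∑ i, |y i| ^ (2 * P) ≤ B₁ ^ P) :
    (n : ℝ) ^ (-((P - 1) / P)) * ∑ i, y i ^ 2 ≤ B₁ := by
  have hn0 : (0 : ℝ) < n := by positivity
  have hs : 0 ≤ ∑ i, y i ^ 2 := Finset.sum_nonneg fun _ _ => sq_nonneg _
  have hP0 : 0 < P := by linarith
  rw [← Real.rpow_le_rpow_iff (by positivity) hB₁ hP0, Real.mul_rpow (by positivity) hs,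
    ← Real.rpow_mul hn0.le]
  have h1 : -((P - 1) / P) * P = -(P - 1) := by field_simp
  rw [h1, Real.rpow_neg hn0.le, inv_mul_le_iff₀ (by positivity)]
  refine (sum_sq_rpow_le hP y).trans ?_
  gcongr

lemma residualSmall_outputGood (hsolve : SolvesSystems A solve) (hn : 2 ≤ n) (hP : 1 ≤ I.P)
    (hI : I.Valid) (h : SmallExponent n I.P) :
    OutputGood A I (2 * I.M ^ 2) (residualSmall A solve I (initSmall n I.P)) := by
  have hhalf := half_le_initSmall hn hP h
  have hM := hI.M_pos
  have hw : ∀ i, 0 < initSmall n I.P i + I.θ i := fun i => by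
    have := hI.θ_nonneg i
    unfold initSmall
    linarith
  unfold residualSmall
  cases hx : leastSquares A solve I.g I.c (fun i => initSmall n I.P i + I.θ i) with
  | none =>
    refine outputGood_certificate fun B ⟨y, _, hy, _⟩ => ?_
    exact absurd hy (not_feasible_of_leastSquares_eq_none hsolve hI.c_ne hw hx y)
  | some x =>
    obtain ⟨hxf, horth⟩ := leastSquares_spec hw hx
    dsimp only
    refine ⟨fun Δ hΔ => ?_, fun B hB hBV => ?_⟩
    · split_ifs at hΔ with hnorm
      obtain rfl := ResidualOutput.primal.inj hΔ
      exact ⟨hxf, hnorm⟩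
    · obtain ⟨y, B₁, hy, hB₁, hpow, hBle⟩ := hB
      have h1 := sum_weight_sq_le (fun i => (hw i).le) (horth y hy)
      simp only [initSmall, add_mul, Finset.sum_add_distrib, ← Finset.mul_sum] at h1
      have h2 := initSmall_mul_sum_sq_le hn hP hB₁ hpow
      have hs : 0 ≤ ∑ i, x i ^ 2 := Finset.sum_nonneg fun _ _ => sq_nonneg _
      have hθ : 0 ≤ ∑ i, I.θ i * x i ^ 2 :=
        Finset.sum_nonneg fun i _ => mul_nonneg (hI.θ_nonneg i) (sq_nonneg _)
      have h3 := mul_le_mul_of_nonneg_right hhalf hs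
      have h4 : ∑ i, x i ^ 2 ≤ 4 * I.M ^ 2 := by linarith
      have hnorm : lpNorm (2 * I.P) x ≤ 2 * I.M := by
        rw [lpNorm_le_iff (by linarith) (by positivity)]
        refine (sum_rpow_two_mul_le hP x).trans
          ((Real.rpow_le_rpow hs h4 (by linarith)).trans (le_of_eq ?_))
        rw [Real.rpow_mul (by positivity), Real.rpow_two]; ring_nf
      rw [if_pos hnorm]
      exact ⟨x, rfl, by linarith⟩

end

/-! ### The residual problem at an iterate -/

section

variable {d n : ℕ} {A : Matrix (Fin d) (Fin n) ℝ} {b : Fin d → ℝ} {p ε : ℝ}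
  {solve : SystemQuery n → Fin (d + 1) → ℝ} {x y Δ : Fin n → ℝ} {M : ℝ}

lemma logb_two_natCast_le (n : ℕ) : Real.logb 2 n ≤ 2 * Real.log n := by
  have h0 : 0 ≤ Real.log n := Real.log_natCast_nonneg n
  rw [Real.logb, div_le_iff₀ (Real.log_pos (by norm_num))]
  nlinarith [Real.log_two_gt_d9]

lemma one_le_kappa (hn : 2 ≤ n) (p : ℝ) : 1 ≤ kappa n p := by
  unfold kappa
  split_ifs with h
  · exact le_rfl
  · have := one_lt_of_not_smallExponent hn h
    rw [le_div_iff₀ (by linarith)]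
    linarith

lemma kappa_le (hn : 2 ≤ n) (p : ℝ) : kappa n p ≤ 2 * Real.log n := by
  have hL := logb_two_natCast_le n
  unfold kappa
  split_ifs with h
  · have : Real.log 2 ≤ Real.log n := Real.log_le_log (by norm_num) (by exact_mod_cast hn)
    linarith [Real.log_two_gt_d9]
  · have hp := one_lt_of_not_smallExponent hn h
    rw [SmallExponent, not_le] at h
    rw [div_le_iff₀ (by linarith)]
    nlinarith

lemma residualInput_valid (hn : 2 ≤ n) (hM : 0 < M) : (residualInput p x M).Valid where
  M_pos := by
    have := one_le_kappa hn p
    have : 0 < √(kappa n p) := Real.sqrt_pos.2 (by linarith)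
    change 0 < 2 * √(kappa n p) * M ^ (1 / p)
    positivity
  c_ne := by
    change M / 2 ≠ 0
    positivity
  θ_nonneg i := by
    change 0 ≤ M ^ ((2 - p) / p) * (2 * |x i| ^ (p - 2))
    positivity

lemma residualInput_M_sq (hn : 2 ≤ n) (hM : 0 < M) :
    (residualInput p x M).M ^ 2 = 4 * kappa n p * M ^ (2 / p) := by
  change (2 * √(kappa n p) * M ^ (1 / p)) ^ 2 = _
  rw [mul_pow, mul_pow, Real.sq_sqrt (by linarith [one_le_kappa hn p]), ← Real.rpow_natCast,
    ← Real.rpow_natCast, ← Real.rpow_mul hM.le]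
  norm_num
  left
  congr 1
  ring

lemma OutputGood.mono {I : ResidualInput n} {V V' : ℝ} {out : ResidualOutput n}
    (h : OutputGood A I V out) (hV : V' ≤ V) : OutputGood A I V' out :=
  ⟨h.1, fun B hB hBV => h.2 B hB (hBV.trans_le hV)⟩

lemma dualExponent_half {p : ℝ} : dualExponent (p / 2) = p / (p - 2) := by
  unfold dualExponent
  rw [show p / 2 - 1 = (p - 2) / 2 by ring, div_div_div_cancel_right₀ (two_ne_zero' ℝ)]

lemma iterScale_dualExponent (hp : 2 < p) :
    iterScale n (dualExponent (p / 2)) = (n : ℝ) ^ ((p - 2) / (3 * p - 2)) := by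
  have h1 : p - 2 ≠ 0 := by linarith
  have h2 : 3 * p - 2 ≠ 0 := by linarith
  rw [iterScale, dualExponent_half]
  congr 1
  have h3 : 2 * (p / (p - 2)) + 1 = (3 * p - 2) / (p - 2) := by field_simp; ring
  rw [h3, one_div_div]

lemma IsPotential.of_exists (hn : 2 ≤ n) {q : ℝ} (hq : 1 < q) : ∃ Ψ, IsPotential n q Ψ := by
  obtain ⟨Ψ, h1, h2, h3, h4⟩ := exists_potential hn hq
  exact ⟨Ψ, h1, h2, h3, h4⟩

lemma ResidualSolver.spec (hsolve : SolvesSystems A solve) (hn : 2 ≤ n) (hp : 2 ≤ p)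
    (hM : 0 < M) {L : List (SystemQuery n)} {out : ResidualOutput n}
    (h : ResidualSolver A solve (residualInput p x M) L out) :
    OutputGood A (residualInput p x M) (2 * M ^ (2 / p)) out ∧ (∀ Q ∈ L, Q.WellFormed) ∧
      (L.length : ℝ) ≤ 765 * (n : ℝ) ^ ((p - 2) / (3 * p - 2)) := by
  have hI := residualInput_valid (p := p) (x := x) hn hM
  have hMsq := residualInput_M_sq (p := p) (x := x) hn hM
  have hM2 : 0 < M ^ (2 / p) := Real.rpow_pos_of_pos hM _
  have hκ := one_le_kappa hn p
  have hN : 1 ≤ (n : ℝ) ^ ((p - 2) / (3 * p - 2)) :=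
    Real.one_le_rpow (by exact_mod_cast (by omega : 1 ≤ n))
      (div_nonneg (by linarith) (by linarith))
  cases h with
  | small h =>
    refine ⟨(residualSmall_outputGood hsolve hn ?_ hI h).mono ?_, ?_, ?_⟩
    · change 1 ≤ p / 2; linarith
    · rw [hMsq]; nlinarith
    · intro Q hQ
      rw [List.mem_singleton] at hQ
      rw [hQ]
      exact residualQuery_wellFormed hI fun i => Real.rpow_nonneg (Nat.cast_nonneg n) _
    · rw [List.length_singleton]; push_cast; linarith
  | large h _ _ hloop =>
    have hP : 1 < (residualInput p x M).P := one_lt_of_not_smallExponent hn h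
    have hP' : 1 < p / 2 := hP
    obtain ⟨Ψ, hΨ⟩ := IsPotential.of_exists hn (one_lt_dualExponent hP)
    obtain ⟨h1, h2, h3⟩ := hloop.spec hsolve hn hP hI hΨ 0 (loopInv_initState hn hP hI hΨ) (by
      have := one_lt_iterScale hn (one_lt_dualExponent hP)
      push_cast
      linarith)
    refine ⟨h1.mono (le_of_eq ?_), h2, ?_⟩
    · have hq : dualExponent (residualInput p x M).P = p / (p - 2) := dualExponent_half
      have hκq : kappa n p = p / (p - 2) := if_neg h
      rw [hMsq, hq, ← hκq]
      field_simp
      norm_num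
    · have hq : iterScale n (dualExponent (residualInput p x M).P) = _ :=
        iterScale_dualExponent (n := n) (by linarith : 2 < p)
      rw [hq] at h3
      push_cast at h3
      linarith

lemma exists_residualSolver (A : Matrix (Fin d) (Fin n) ℝ)
    (solve : SystemQuery n → Fin (d + 1) → ℝ) (hn : 2 ≤ n) (p : ℝ) (x : Fin n → ℝ)
    (hM : 0 < M) : ∃ L out, ResidualSolver A solve (residualInput p x M) L out := by
  by_cases h : SmallExponent n (residualInput p x M).P
  · exact ⟨_, _, .small h⟩
  · have hI := residualInput_valid (p := p) (x := x) hn hM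
    have hP : 1 < (residualInput p x M).P := one_lt_of_not_smallExponent hn h
    obtain ⟨Ψ, hΨ⟩ := IsPotential.of_exists hn (one_lt_dualExponent hP)
    obtain ⟨m, hm⟩ := exists_nat_gt (764 * iterScale n (dualExponent (residualInput p x M).P))
    obtain ⟨L, out, hL⟩ := exists_residualLoop (A := A) (solve := solve) hn hP hI hΨ m _ 0
      (loopInv_initState hn hP hI hΨ) (by push_cast; linarith)
    exact ⟨L, out, .large h L out hL⟩

/-- A large gap to the optimum gives a feasible vector of small value for the residual problem: a
multiple of `(x - y) / 16`. -/
lemma residualValueLE_of_gap (hp : 2 ≤ p) (hM : 0 < M) (hxy : A *ᵥ x = A *ᵥ y)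
    (hgap : 8 * p * M < lpNorm p x ^ p - lpNorm p y ^ p) :
    ResidualValueLE A (residualInput p x M) (9 / 8 * M ^ (2 / p)) := by
  have hp0 : 0 < p := by linarith
  rw [lpNorm_rpow hp0, lpNorm_rpow hp0] at hgap
  set δ : Fin n → ℝ := fun i => (x i - y i) / 16 with hδ
  set a := ∑ i, |x i| ^ (p - 2) * x i * δ i with ha
  set β := ∑ i, 2 * |x i| ^ (p - 2) * δ i ^ 2 with hβ
  set γ := ∑ i, |δ i| ^ p with hγ
  have hβ0 : 0 ≤ β := Finset.sum_nonneg fun i _ => by positivity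
  have hγ0 : 0 ≤ γ := sum_abs_rpow_nonneg p δ
  have h1 : M / 2 < a - β - γ := by
    have h2 := Finset.sum_le_sum fun i (_ : i ∈ Finset.univ) => le_abs_sub_rpow hp (x i) (δ i)
    have h3 : ∀ i, x i - 16 * δ i = y i := fun i => by rw [hδ]; ring
    simp only [h3, Finset.sum_sub_distrib, ← Finset.mul_sum] at h2
    have h4 : (16 * p) * (M / 2) < (16 * p) * (a - β - γ) := by
      have : (∑ i, 2 * |x i| ^ (p - 2) * δ i ^ 2) = β := rfl
      linarith
    exact lt_of_mul_lt_mul_left h4 (by linarith)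
  have ha0 : 0 < a := by linarith
  set s := M / (2 * a) with hs
  have hs0 : 0 < s := by positivity
  have hsa : s * a = M / 2 := by rw [hs]; field_simp
  have hs1 : s ≤ 1 := by
    rw [hs, div_le_one (by positivity)]; linarith
  -- `s² (β + γ) ≤ s² (a - M/2) = (M/2) s (1 - s)`
  have h2 : s ^ 2 * (β + γ) ≤ M / 8 := by
    have h3 : s ^ 2 * (β + γ) ≤ s ^ 2 * (a - M / 2) :=
      mul_le_mul_of_nonneg_left (by linarith) (sq_nonneg s)
    have h4 : s ^ 2 * (a - M / 2) = M / 2 * (s * (1 - s)) := by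
      have : s ^ 2 * (a - M / 2) = s * (s * a) - s ^ 2 * (M / 2) := by ring
      rw [this, hsa]; ring
    nlinarith [sq_nonneg (s - 1 / 2)]
  have hsβ : s ^ 2 * β ≤ M / 8 := by nlinarith [mul_nonneg (sq_nonneg s) hγ0]
  have hsγ : s ^ 2 * γ ≤ M / 8 := by nlinarith [mul_nonneg (sq_nonneg s) hβ0]
  refine ⟨fun i => s * δ i, M ^ (2 / p), ⟨?_, ?_⟩, by positivity, ?_, ?_⟩
  · have h3 : (fun i => s * δ i) = (s / 16) • (x - y) := by
      ext i; rw [hδ]; simp; ring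
    rw [h3, mulVec_smul, mulVec_sub, hxy, sub_self, smul_zero]
  · change ∑ i, |x i| ^ (p - 2) * x i * (s * δ i) = M / 2
    rw [← hsa, ha, Finset.mul_sum]
    exact Finset.sum_congr rfl fun i _ => by ring
  · change ∑ i, |s * δ i| ^ (2 * (p / 2)) ≤ (M ^ (2 / p)) ^ (p / 2)
    rw [← Real.rpow_mul hM.le, mul_div_cancel₀ p (two_ne_zero' ℝ),
      show 2 / p * (p / 2) = 1 by field_simp, Real.rpow_one]
    have h3 : ∑ i, |s * δ i| ^ p = s ^ p * γ := by
      rw [hγ, Finset.mul_sum]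
      exact Finset.sum_congr rfl fun i _ => by
        rw [abs_mul, abs_of_pos hs0, Real.mul_rpow hs0.le (abs_nonneg _)]
    have h4 : s ^ p ≤ s ^ 2 := by
      rw [← Real.rpow_two]
      exact Real.rpow_le_rpow_of_exponent_ge hs0 hs1 hp
    rw [h3]
    have := mul_le_mul_of_nonneg_right h4 hγ0
    linarith
  · change M ^ (2 / p) + ∑ i, M ^ ((2 - p) / p) * (2 * |x i| ^ (p - 2)) * (s * δ i) ^ 2 ≤ _
    have h3 : ∑ i, M ^ ((2 - p) / p) * (2 * |x i| ^ (p - 2)) * (s * δ i) ^ 2 =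
        M ^ ((2 - p) / p) * (s ^ 2 * β) := by
      rw [hβ, Finset.mul_sum, Finset.mul_sum]
      exact Finset.sum_congr rfl fun i _ => by ring
    have h4 : M ^ ((2 - p) / p) * M = M ^ (2 / p) := by
      rw [← Real.rpow_add_one hM.ne']; congr 1; field_simp; ring
    have h5 : M ^ ((2 - p) / p) * (s ^ 2 * β) ≤ M ^ ((2 - p) / p) * (M / 8) :=
      mul_le_mul_of_nonneg_left hsβ (by positivity)
    rw [h3]
    linarith

/-- If the residual solver yields no step, the gap to the optimum is at most `8 p M`. -/
lemma gap_le_of_noStep (hp : 2 ≤ p) (hM : 0 < M) (hxy : A *ᵥ x = A *ᵥ y)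
    {out : ResidualOutput n}
    (hgood : OutputGood A (residualInput p x M) (2 * M ^ (2 / p)) out)
    (hout : NoStep p x M out) : lpNorm p x ^ p - lpNorm p y ^ p ≤ 8 * p * M := by
  by_contra! hgap
  have hM2 : 0 < M ^ (2 / p) := Real.rpow_pos_of_pos hM _
  obtain ⟨Δ, rfl, hΔ⟩ := hgood.2 _ (residualValueLE_of_gap hp hM hxy hgap) (by linarith)
  have h1 : 2 * M ≤ ∑ i, weightR p x i * Δ i ^ 2 := hout
  have h2 : ∑ i, M ^ ((2 - p) / p) * weightR p x i * Δ i ^ 2 ≤ 9 / 8 * M ^ (2 / p) := hΔ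
  simp only [mul_assoc, ← Finset.mul_sum] at h2
  have h4 : M ^ (2 / p) = M ^ ((2 - p) / p) * M := by
    rw [← Real.rpow_add_one hM.ne']; congr 1; field_simp; ring
  rw [h4] at h2
  have h5 : 0 < M ^ ((2 - p) / p) := Real.rpow_pos_of_pos hM _
  have h6 : M ^ ((2 - p) / p) * ∑ i, weightR p x i * Δ i ^ 2 ≤
      M ^ ((2 - p) / p) * (9 / 8 * M) := by linarith
  have := le_of_mul_le_mul_left h6 h5
  linarith

/-- A step lowers `‖x‖_p^p` by at least a constant multiple of `M / κ`. -/
lemma lpNorm_rpow_step_le (hn : 2 ≤ n) (hp : 2 ≤ p) (hM : 0 < M)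
    (hgood : OutputGood A (residualInput p x M) (2 * M ^ (2 / p)) (.primal Δ))
    (hout : ¬ NoStep p x M (.primal Δ)) :
    A *ᵥ (fun i => x i - Δ i / (64 * p * kappa n p)) = A *ᵥ x ∧
      lpNorm p (fun i => x i - Δ i / (64 * p * kappa n p)) ^ p ≤
        lpNorm p x ^ p - 7 / 2048 * (M / kappa n p) := by
  have hp0 : 0 < p := by linarith
  obtain ⟨⟨hA, hg⟩, hnorm⟩ := hgood.1 Δ rfl
  have hκ := one_le_kappa hn p
  set κ := kappa n p with hκdef
  have hR : ∑ i, weightR p x i * Δ i ^ 2 < 2 * M := not_le.1 hout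
  have hg' : ∑ i, |x i| ^ (p - 2) * x i * Δ i = M / 2 := hg
  have hsqrt : 1 ≤ √κ := Real.one_le_sqrt.2 hκ
  have hκsq : √κ * √κ = κ := Real.mul_self_sqrt (by linarith)
  have hΔ : ∑ i, |Δ i| ^ p ≤ (4 * √κ) ^ p * M := by
    have h1 : lpNorm (2 * (p / 2)) Δ ≤ 2 * (2 * √κ * M ^ (1 / p)) := hnorm
    rw [mul_div_cancel₀ p (two_ne_zero' ℝ), lpNorm_le_iff hp0 (by positivity)] at h1
    refine h1.trans (le_of_eq ?_)
    rw [show 2 * (2 * √κ * M ^ (1 / p)) = (4 * √κ) * M ^ (1 / p) by ring,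
      Real.mul_rpow (by positivity) (by positivity), ← Real.rpow_mul hM.le,
      one_div_mul_cancel hp0.ne', Real.rpow_one]
  refine ⟨?_, ?_⟩
  · have h1 : (fun i => x i - Δ i / (64 * p * κ)) = x - (64 * p * κ)⁻¹ • Δ := by
      ext i; simp [div_eq_inv_mul]
    rw [h1, mulVec_sub, mulVec_smul, hA, smul_zero, sub_zero]
  · rw [lpNorm_rpow hp0, lpNorm_rpow hp0]
    have h1 := Finset.sum_le_sum fun i (_ : i ∈ Finset.univ) =>
      abs_sub_div_rpow_le hp (x i) (Δ i / (64 * κ))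
    have h2 : ∀ i, x i - Δ i / (64 * κ) / p = x i - Δ i / (64 * p * κ) := fun i => by
      rw [div_div]; ring_nf
    simp only [h2, Finset.sum_add_distrib, Finset.sum_sub_distrib] at h1
    have h3 : ∑ i, |x i| ^ (p - 2) * x i * (Δ i / (64 * κ)) = M / 2 / (64 * κ) := by
      rw [← hg', Finset.sum_div]
      exact Finset.sum_congr rfl fun i _ => by ring
    have h4 : ∑ i, 2 * |x i| ^ (p - 2) * (Δ i / (64 * κ)) ^ 2 ≤ 2 * M / (64 * κ) ^ 2 := by
      have h5 : ∑ i, 2 * |x i| ^ (p - 2) * (Δ i / (64 * κ)) ^ 2 =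
          (∑ i, weightR p x i * Δ i ^ 2) / (64 * κ) ^ 2 := by
        rw [Finset.sum_div]
        exact Finset.sum_congr rfl fun i _ => by rw [weightR]; ring
      rw [h5]
      gcongr
    have h5 : ∑ i, |Δ i / (64 * κ)| ^ p ≤ M / (256 * κ) := by
      have h6 : ∑ i, |Δ i / (64 * κ)| ^ p = (∑ i, |Δ i| ^ p) / (64 * κ) ^ p := by
        rw [Finset.sum_div]
        exact Finset.sum_congr rfl fun i _ => by
          rw [abs_div, abs_of_pos (by positivity : 0 < 64 * κ),
            Real.div_rpow (abs_nonneg _) (by positivity)]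
      have h7 : (4 * √κ) ^ p / (64 * κ) ^ p ≤ 1 / (256 * κ) := by
        rw [← Real.div_rpow (by positivity) (by positivity)]
        have h8 : 4 * √κ / (64 * κ) = 1 / (16 * √κ) := by
          nth_rw 2 [← hκsq]
          field_simp
          norm_num
        rw [h8]
        have h9 : (1 / (16 * √κ)) ^ p ≤ (1 / (16 * √κ)) ^ (2 : ℝ) := by
          refine Real.rpow_le_rpow_of_exponent_ge (by positivity) ?_ hp
          rw [div_le_one (by positivity)]
          linarith
        refine h9.trans (le_of_eq ?_)
        rw [Real.rpow_two, div_pow, mul_pow, Real.sq_sqrt (by linarith)]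
        norm_num
      rw [h6]
      calc (∑ i, |Δ i| ^ p) / (64 * κ) ^ p ≤ (4 * √κ) ^ p * M / (64 * κ) ^ p := by gcongr
        _ = (4 * √κ) ^ p / (64 * κ) ^ p * M := by ring
        _ ≤ 1 / (256 * κ) * M := by gcongr
        _ = M / (256 * κ) := by ring
    have h6 : 2 * M / (64 * κ) ^ 2 ≤ 1 / 2048 * (M / κ) := by
      have h7 : 2 * M / (64 * κ) ^ 2 = 1 / 2048 * (M / κ) * (1 / κ) := by
        field_simp
        norm_num
      rw [h7]
      exact mul_le_of_le_one_right (by positivity) ((div_le_one (by linarith)).2 hκ)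
    have h7 : M / 2 / (64 * κ) = 1 / 128 * (M / κ) := by field_simp; norm_num
    have h8 : M / (256 * κ) = 1 / 256 * (M / κ) := by field_simp
    linarith

end

/-! ### Iterative refinement -/

section

variable {d n : ℕ} {A : Matrix (Fin d) (Fin n) ℝ} {b : Fin d → ℝ} {p ε F : ℝ}
  {solve : SystemQuery n → Fin (d + 1) → ℝ} {x y Δ : Fin n → ℝ} {M : ℝ}

/-- The invariant of the refinement loop: `x` solves the system, and `16 p M` bounds the gap of
`‖x‖_p^p` to the optimum. -/
structure RefineInv (A : Matrix (Fin d) (Fin n) ℝ) (b : Fin d → ℝ) (p : ℝ) (x : Fin n → ℝ)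
    (M : ℝ) : Prop where
  sol : A *ᵥ x = b
  gap : ∀ y, A *ᵥ y = b → lpNorm p x ^ p - lpNorm p y ^ p ≤ 16 * p * M

lemma pos_of_threshold_lt (hp : 2 ≤ p) (hε : 0 < ε)
    (hM : ε / (16 * p * (1 + ε)) * lpNorm p x ^ p < M) : 0 < M := by
  refine lt_of_le_of_lt ?_ hM
  have := lpNorm_nonneg (by linarith : 0 < p) x
  positivity

lemma RefineInv.halve (h : RefineInv A b p x M) (hp : 2 ≤ p) (hM : 0 < M)
    {out : ResidualOutput n}
    (hgood : OutputGood A (residualInput p x M) (2 * M ^ (2 / p)) out)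
    (hout : NoStep p x M out) : RefineInv A b p x (M / 2) where
  sol := h.sol
  gap y hy := by
    have := gap_le_of_noStep hp hM (h.sol.trans hy.symm) hgood hout
    linarith

lemma RefineInv.step (h : RefineInv A b p x M) (hn : 2 ≤ n) (hp : 2 ≤ p) (hM : 0 < M)
    (hgood : OutputGood A (residualInput p x M) (2 * M ^ (2 / p)) (.primal Δ))
    (hout : ¬ NoStep p x M (.primal Δ)) :
    RefineInv A b p (fun i => x i - Δ i / (64 * p * kappa n p)) M := by
  obtain ⟨h1, h2⟩ := lpNorm_rpow_step_le hn hp hM hgood hout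
  refine ⟨h1.trans h.sol, fun y hy => ?_⟩
  have h3 := h.gap y hy
  have : 0 < M / kappa n p := div_pos hM (by linarith [one_le_kappa hn p])
  linarith

/-- Partial correctness of the refinement loop, and the cost of each residual problem. -/
lemma RefineLoop.correct (hsolve : SolvesSystems A solve) (hn : 2 ≤ n) (hp : 2 ≤ p)
    (hε : 0 < ε) {log : List (List (SystemQuery n))}
    (hloop : RefineLoop A p ε solve x M log y) :
    RefineInv A b p x M →
      (A *ᵥ y = b ∧ ∀ z, A *ᵥ z = b → lpNorm p y ≤ (1 + ε) * lpNorm p z) ∧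
        ∀ L ∈ log, (L.length : ℝ) ≤ 765 * (n : ℝ) ^ ((p - 2) / (3 * p - 2)) ∧
          ∀ Q ∈ L, Q.WellFormed := by
  have hp0 : 0 < p := by linarith
  induction hloop with
  | exit x M hM =>
    intro h
    refine ⟨⟨h.sol, fun z hz => ?_⟩, by simp⟩
    have hz0 := lpNorm_nonneg hp0 z
    rw [lpNorm_le_iff hp0 (by positivity), ← lpNorm_rpow hp0, Real.mul_rpow (by positivity) hz0]
    have h1 := h.gap z hz
    have h2 : 16 * p * M ≤ ε / (1 + ε) * lpNorm p x ^ p := by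
      have h3 := mul_le_mul_of_nonneg_left hM (by positivity : 0 ≤ 16 * p)
      refine h3.trans (le_of_eq ?_)
      field_simp
    have h3 : lpNorm p x ^ p ≤ (1 + ε) * lpNorm p z ^ p := by
      have h4 : lpNorm p x ^ p - ε / (1 + ε) * lpNorm p x ^ p = lpNorm p x ^ p / (1 + ε) := by
        field_simp
        ring
      have h5 : lpNorm p x ^ p / (1 + ε) ≤ lpNorm p z ^ p := by linarith
      rw [div_le_iff₀ (by positivity)] at h5
      linarith
    refine h3.trans (mul_le_mul_of_nonneg_right ?_ (Real.rpow_nonneg hz0 _))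
    exact Real.self_le_rpow_of_one_le (by linarith) (by linarith)
  | halve x M L out log y hM hres hout _ ih =>
    intro h
    have hM0 := pos_of_threshold_lt hp hε hM
    obtain ⟨h1, h2, h3⟩ := hres.spec hsolve hn hp hM0
    obtain ⟨h4, h5⟩ := ih (h.halve hp hM0 h1 hout)
    exact ⟨h4, List.forall_mem_cons.2 ⟨⟨h3, h2⟩, h5⟩⟩
  | step x M L Δ log y hM hres hout _ ih =>
    intro h
    have hM0 := pos_of_threshold_lt hp hε hM
    obtain ⟨h1, h2, h3⟩ := hres.spec hsolve hn hp hM0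
    obtain ⟨h4, h5⟩ := ih (h.step hn hp hM0 h1 hout)
    exact ⟨h4, List.forall_mem_cons.2 ⟨⟨h3, h2⟩, h5⟩⟩

/-- The scale `ε F / (16 p (1 + ε))` below which `M` cannot be halved again, where `F` is the
infimum of `‖y‖_p^p`. -/
def minBound (p ε F : ℝ) : ℝ := ε / (16 * p * (1 + ε)) * F

/-- The potential of the refinement loop, which drops by at least `1` with each residual problem:
its first part counts the steps possible at the current `M`, its second part the remaining
halvings, each of which makes room for at most `(2048/7) κ · 8 p` further steps. -/
def refinePotential (n : ℕ) (p ε F : ℝ) (x : Fin n → ℝ) (M : ℝ) : ℝ :=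
  2048 / 7 * kappa n p * ((lpNorm p x ^ p - F) / M) +
    (1 + 2048 / 7 * kappa n p * (8 * p)) * Real.logb 2 (2 * M / minBound p ε F)

/-- The hypotheses under which the potential is used. -/
structure RefineBound (A : Matrix (Fin d) (Fin n) ℝ) (b : Fin d → ℝ) (p ε F : ℝ)
    (x : Fin n → ℝ) (M : ℝ) : Prop extends RefineInv A b p x M where
  M_gt : minBound p ε F < 2 * M

lemma minBound_pos (hp : 2 ≤ p) (hε : 0 < ε) (hF : 0 < F) : 0 < minBound p ε F := by
  have : 0 < p := by linarith
  unfold minBound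
  positivity

lemma minBound_lt (hF : IsGLB ((fun y => lpNorm p y ^ p) '' {y | A *ᵥ y = b}) F) (hp : 2 ≤ p)
    (hε : 0 < ε) (hx : A *ᵥ x = b) (hM : ε / (16 * p * (1 + ε)) * lpNorm p x ^ p < M) :
    minBound p ε F < M := by
  have hp0 : 0 < p := by linarith
  exact lt_of_le_of_lt (mul_le_mul_of_nonneg_left (hF.1 ⟨x, hx, rfl⟩) (by positivity)) hM

lemma RefineBound.potential_nonneg (h : RefineBound A b p ε F x M)
    (hF : IsGLB ((fun y => lpNorm p y ^ p) '' {y | A *ᵥ y = b}) F) (hF0 : 0 < F) (hn : 2 ≤ n)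
    (hp : 2 ≤ p) (hε : 0 < ε) : 0 ≤ refinePotential n p ε F x M := by
  have hm := minBound_pos hp hε hF0
  have hM : 0 < M := by linarith [h.M_gt]
  have h1 : F ≤ lpNorm p x ^ p := hF.1 ⟨x, h.sol, rfl⟩
  have h2 : 0 ≤ Real.logb 2 (2 * M / minBound p ε F) :=
    Real.logb_nonneg (by norm_num) ((one_le_div hm).2 h.M_gt.le)
  have hκ := one_le_kappa hn p
  have h3 : 0 ≤ (lpNorm p x ^ p - F) / M := div_nonneg (by linarith) hM.le
  unfold refinePotential
  positivity

lemma RefineBound.halve (h : RefineBound A b p ε F x M)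
    (hF : IsGLB ((fun y => lpNorm p y ^ p) '' {y | A *ᵥ y = b}) F) (hF0 : 0 < F) (hn : 2 ≤ n)
    (hp : 2 ≤ p) (hε : 0 < ε) {out : ResidualOutput n}
    (hM : ε / (16 * p * (1 + ε)) * lpNorm p x ^ p < M)
    (hgood : OutputGood A (residualInput p x M) (2 * M ^ (2 / p)) out)
    (hout : NoStep p x M out) :
    RefineBound A b p ε F x (M / 2) ∧
      refinePotential n p ε F x (M / 2) + 1 ≤ refinePotential n p ε F x M := by
  have hm := minBound_pos hp hε hF0
  have hM0 := pos_of_threshold_lt hp hε hM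
  have hlt := minBound_lt hF hp hε h.sol hM
  have h1 := h.toRefineInv.halve hp hM0 hgood hout
  refine ⟨⟨h1, by linarith⟩, ?_⟩
  have h2 : lpNorm p x ^ p - 8 * p * M ≤ F := by
    refine hF.2 ?_
    rintro _ ⟨y, hy, rfl⟩
    have := h1.gap y hy
    dsimp only
    linarith
  have hκ := one_le_kappa hn p
  have h3 : Real.logb 2 (2 * (M / 2) / minBound p ε F) =
      Real.logb 2 (2 * M / minBound p ε F) - 1 := by
    rw [show 2 * (M / 2) / minBound p ε F = 2 * M / minBound p ε F / 2 by ring,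
      Real.logb_div (by positivity) (by norm_num), Real.logb_self_eq_one (by norm_num)]
  have h4 : (lpNorm p x ^ p - F) / (M / 2) = 2 * ((lpNorm p x ^ p - F) / M) := by
    field_simp
  have h5 : (lpNorm p x ^ p - F) / M ≤ 8 * p := by
    rw [div_le_iff₀ hM0]; linarith
  have h6 := mul_le_mul_of_nonneg_left h5 (by positivity : 0 ≤ 2048 / 7 * kappa n p)
  unfold refinePotential
  rw [h3, h4]
  linarith

lemma RefineBound.step (h : RefineBound A b p ε F x M) (hn : 2 ≤ n) (hp : 2 ≤ p)
    (hM : 0 < M)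
    (hgood : OutputGood A (residualInput p x M) (2 * M ^ (2 / p)) (.primal Δ))
    (hout : ¬ NoStep p x M (.primal Δ)) :
    RefineBound A b p ε F (fun i => x i - Δ i / (64 * p * kappa n p)) M ∧
      refinePotential n p ε F (fun i => x i - Δ i / (64 * p * kappa n p)) M + 1 ≤
        refinePotential n p ε F x M := by
  refine ⟨⟨h.toRefineInv.step hn hp hM hgood hout, h.M_gt⟩, ?_⟩
  have h1 := (lpNorm_rpow_step_le hn hp hM hgood hout).2
  have hκ := one_le_kappa hn p
  set κ := kappa n p with hκdef
  set u := lpNorm p (fun i => x i - Δ i / (64 * p * κ)) ^ p with hu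
  have h2 : (u - F) / M ≤ (lpNorm p x ^ p - F) / M - 7 / 2048 / κ := by
    rw [div_le_iff₀ hM, sub_mul, div_mul_cancel₀ _ hM.ne']
    have : 7 / 2048 / κ * M = 7 / 2048 * (M / κ) := by ring
    linarith
  have h3 := mul_le_mul_of_nonneg_left h2 (by positivity : 0 ≤ 2048 / 7 * κ)
  have h4 : 2048 / 7 * κ * ((lpNorm p x ^ p - F) / M - 7 / 2048 / κ) =
      2048 / 7 * κ * ((lpNorm p x ^ p - F) / M) - 1 := by
    field_simp
  unfold refinePotential
  rw [← hκdef, ← hu]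
  linarith

lemma RefineLoop.length_le (hsolve : SolvesSystems A solve) (hn : 2 ≤ n) (hp : 2 ≤ p)
    (hε : 0 < ε) (hF : IsGLB ((fun y => lpNorm p y ^ p) '' {y | A *ᵥ y = b}) F) (hF0 : 0 < F)
    {log : List (List (SystemQuery n))} (hloop : RefineLoop A p ε solve x M log y) :
    RefineBound A b p ε F x M → (log.length : ℝ) ≤ refinePotential n p ε F x M := by
  induction hloop with
  | exit x M hM =>
    intro h
    simpa using h.potential_nonneg hF hF0 hn hp hε
  | halve x M L out log y hM hres hout _ ih =>
    intro h
    have hM0 := pos_of_threshold_lt hp hε hM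
    obtain ⟨h1, h2⟩ := h.halve hF hF0 hn hp hε hM (hres.spec hsolve hn hp hM0).1 hout
    rw [List.length_cons]
    push_cast
    linarith [ih h1]
  | step x M L Δ log y hM hres hout _ ih =>
    intro h
    have hM0 := pos_of_threshold_lt hp hε hM
    obtain ⟨h1, h2⟩ := h.step hn hp hM0 (hres.spec hsolve hn hp hM0).1 hout
    rw [List.length_cons]
    push_cast
    linarith [ih h1]

lemma exists_refineLoop (hsolve : SolvesSystems A solve) (hn : 2 ≤ n) (hp : 2 ≤ p)
    (hε : 0 < ε) (hF : IsGLB ((fun y => lpNorm p y ^ p) '' {y | A *ᵥ y = b}) F) (hF0 : 0 < F)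
    (m : ℕ) : ∀ (x : Fin n → ℝ) (M : ℝ), RefineBound A b p ε F x M →
      refinePotential n p ε F x M < m → ∃ log y, RefineLoop A p ε solve x M log y := by
  induction m with
  | zero =>
    intro x M h hlt
    have := h.potential_nonneg hF hF0 hn hp hε
    push_cast at hlt
    linarith
  | succ m ih =>
    intro x M h hlt
    rcases le_or_gt M (ε / (16 * p * (1 + ε)) * lpNorm p x ^ p) with hM | hM
    · exact ⟨_, _, .exit x M hM⟩
    have hM0 := pos_of_threshold_lt hp hε hM
    obtain ⟨L, out, hres⟩ := exists_residualSolver A solve hn p x hM0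
    have hgood := (hres.spec hsolve hn hp hM0).1
    push_cast at hlt
    by_cases hout : NoStep p x M out
    · obtain ⟨h1, h2⟩ := h.halve hF hF0 hn hp hε hM hgood hout
      obtain ⟨log, y, hlog⟩ := ih _ _ h1 (by linarith)
      exact ⟨_, _, .halve x M L out log y hM hres hout hlog⟩
    · cases out with
      | certificate r => exact absurd trivial hout
      | primal Δ =>
        obtain ⟨h1, h2⟩ := h.step hn hp hM0 hgood hout
        obtain ⟨log, y, hlog⟩ := ih _ _ h1 (by linarith)
        exact ⟨_, _, .step x M L Δ log y hM hres hout hlog⟩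

/-! ### The initial iterate -/

lemma lpNorm_two_le_iff : lpNorm 2 x ≤ lpNorm 2 y ↔ ∑ i, x i ^ 2 ≤ ∑ i, y i ^ 2 := by
  rw [lpNorm_le_iff two_pos (lpNorm_nonneg two_pos y), lpNorm_rpow two_pos]
  simp

lemma exists_isLeastNormSolution (h : ∃ x, A *ᵥ x = b) : ∃ x, IsLeastNormSolution A b x := by
  obtain ⟨x, rfl⟩ := h
  obtain ⟨φ, hφ⟩ := exists_mul_diagonal_mul_transpose_mulVec A (D := fun _ => 1)
    (fun _ => one_pos) x
  rw [diagonal_one, Matrix.mul_one, ← mulVec_mulVec] at hφ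
  refine ⟨Aᵀ *ᵥ φ, hφ, fun y hy => lpNorm_two_le_iff.2 ?_⟩
  have h1 : ∀ z, A *ᵥ z = A *ᵥ x → Aᵀ *ᵥ φ ⬝ᵥ z = φ ⬝ᵥ A *ᵥ x := fun z hz => by
    rw [← hz, dotProduct_mulVec, mulVec_transpose]
  have h2 := sum_weight_sq_le (w := fun _ => 1) (x := Aᵀ *ᵥ φ) (y := y) (fun _ => zero_le_one) (by
    have h3 := (h1 y hy).trans (h1 _ hφ).symm
    simp only [dotProduct] at h3
    simpa [sq] using h3)
  simpa using h2

/-- The solution of least `ℓ₂` norm is optimal for `‖·‖_p^p` up to the factor `n^(p/2-1)`. -/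
lemma IsLeastNormSolution.lpNorm_rpow_le (h : IsLeastNormSolution A b x) (hp : 2 ≤ p)
    (hy : A *ᵥ y = b) : lpNorm p x ^ p ≤ (n : ℝ) ^ (p / 2 - 1) * lpNorm p y ^ p := by
  have hp0 : 0 < p := by linarith
  have hp2 : 1 ≤ p / 2 := by linarith
  have h1 := lpNorm_two_le_iff.1 (h.2 y hy)
  rw [lpNorm_rpow hp0, lpNorm_rpow hp0, ← mul_div_cancel₀ p (two_ne_zero' ℝ)]
  refine (sum_rpow_two_mul_le hp2 x).trans ((Real.rpow_le_rpow ?_ h1 (by linarith)).trans ?_)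
  · exact Finset.sum_nonneg fun _ _ => sq_nonneg _
  · rw [mul_div_cancel₀ p (two_ne_zero' ℝ)]
    have h2 := sum_sq_rpow_le hp2 y
    rwa [mul_div_cancel₀ p (two_ne_zero' ℝ)] at h2

lemma refinePotential_initial_le (hn : 2 ≤ n) (hp : 2 ≤ p) (hε : 0 < ε) (hε1 : ε ≤ 1)
    (hF0 : 0 < F) (hFx : F ≤ lpNorm p x ^ p)
    (hxF : lpNorm p x ^ p ≤ (n : ℝ) ^ (p / 2 - 1) * F) :
    refinePotential n p ε F x (lpNorm p x ^ p / (16 * p)) ≤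
      30000 * (p ^ 2 * Real.log n * Real.log (n / ε)) := by
  have hp0 : 0 < p := by linarith
  have hn0 : (0 : ℝ) < n := by positivity
  have hκ := one_le_kappa hn p
  have hκ2 := kappa_le hn p
  have hm := minBound_pos hp hε hF0
  have hl2 := Real.log_two_gt_d9
  have hl2n : Real.log 2 ≤ Real.log n := Real.log_le_log (by norm_num) (by exact_mod_cast hn)
  have hfx : 0 < lpNorm p x ^ p := hF0.trans_le hFx
  set f := lpNorm p x ^ p
  have hlogε : Real.log ε ≤ 0 := Real.log_nonpos hε.le hε1
  set D := Real.log (n / ε) with hD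
  have hD' : D = Real.log n - Real.log ε := Real.log_div hn0.ne' hε.ne'
  have h1 : (f - F) / (f / (16 * p)) ≤ 16 * p := by
    rw [div_le_iff₀ (by positivity)]
    have : 16 * p * (f / (16 * p)) = f := by field_simp
    linarith
  have h2 : 2 * (f / (16 * p)) / minBound p ε F ≤ 4 * (n : ℝ) ^ (p / 2 - 1) / ε := by
    have h3 : 2 * (f / (16 * p)) / minBound p ε F = 2 * (1 + ε) * (f / F) / ε := by
      unfold minBound
      field_simp
    rw [h3]
    have h4 : f / F ≤ (n : ℝ) ^ (p / 2 - 1) := (div_le_iff₀ hF0).2 hxF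
    gcongr
    linarith
  have h3 : Real.log (2 * (f / (16 * p)) / minBound p ε F) ≤ p * D := by
    refine (Real.log_le_log (by positivity) h2).trans ?_
    rw [Real.log_div (by positivity) hε.ne', Real.log_mul (by norm_num) (by positivity),
      Real.log_rpow hn0, show (4 : ℝ) = 2 ^ 2 by norm_num, Real.log_pow]
    push_cast
    rw [hD']
    linarith [mul_nonneg (by linarith : 0 ≤ p - 2) (by linarith : 0 ≤ Real.log n),
      mul_nonneg (by linarith : 0 ≤ p - 1) (by linarith : 0 ≤ -Real.log ε)]
  have h4 : Real.logb 2 (2 * (f / (16 * p)) / minBound p ε F) ≤ 2 * (p * D) := by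
    rw [Real.logb, div_le_iff₀ (by linarith)]
    have h4 : 0 ≤ p * D := mul_nonneg hp0.le (by linarith)
    have h5 := mul_le_mul_of_nonneg_left (by linarith : 1 / 2 ≤ Real.log 2) h4
    linarith
  have hpD : 1 ≤ p * D := by
    have := mul_le_mul hp (by linarith : 1 / 2 ≤ D) (by norm_num) hp0.le
    linarith
  have hκp : 1 ≤ kappa n p * p := one_le_mul_of_one_le_of_one_le hκ (by linarith)
  have h5 : refinePotential n p ε F x (f / (16 * p)) ≤
      2048 / 7 * kappa n p * (16 * p) +
        (1 + 2048 / 7 * kappa n p * (8 * p)) * (2 * (p * D)) := by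
    unfold refinePotential
    gcongr
  have h6 : 0 ≤ kappa n p * p * (p * D - 1) :=
    mul_nonneg (by positivity) (by linarith)
  have h7 : 0 ≤ (kappa n p * p - 1) * (p * D) :=
    mul_nonneg (by linarith) (by linarith)
  have h8 : kappa n p * (p * (p * D)) ≤ 2 * Real.log n * (p * (p * D)) :=
    mul_le_mul_of_nonneg_right hκ2 (by positivity)
  have h9 : 0 ≤ Real.log n * (p * (p * D)) :=
    mul_nonneg (by linarith) (by positivity)
  linarith

/-! ### The complete algorithm -/

lemma exists_isGLB_lpNorm_rpow (hp : 0 < p) (hb : ∃ x, A *ᵥ x = b) :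
    ∃ F, IsGLB ((fun y => lpNorm p y ^ p) '' {y | A *ᵥ y = b}) F := by
  obtain ⟨x, hx⟩ := hb
  refine ⟨_, isGLB_csInf ⟨_, x, hx, rfl⟩ ⟨0, ?_⟩⟩
  rintro _ ⟨y, -, rfl⟩
  exact Real.rpow_nonneg (lpNorm_nonneg hp y) p

lemma IsLeastNormSolution.lpNorm_rpow_le_isGLB (h : IsLeastNormSolution A b x) (hp : 2 ≤ p)
    (hn : 2 ≤ n) (hF : IsGLB ((fun y => lpNorm p y ^ p) '' {y | A *ᵥ y = b}) F) :
    lpNorm p x ^ p ≤ (n : ℝ) ^ (p / 2 - 1) * F := by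
  have hn0 : (0 : ℝ) < n := by positivity
  have hnpow : 0 < (n : ℝ) ^ (p / 2 - 1) := Real.rpow_pos_of_pos hn0 _
  rw [← div_le_iff₀' hnpow]
  refine hF.2 ?_
  rintro _ ⟨y, hy, rfl⟩
  rw [div_le_iff₀' hnpow]
  exact h.lpNorm_rpow_le hp hy

lemma IsLeastNormSolution.pos_of_isGLB (h : IsLeastNormSolution A b x) (hp : 2 ≤ p)
    (hn : 2 ≤ n) (hF : IsGLB ((fun y => lpNorm p y ^ p) '' {y | A *ᵥ y = b}) F)
    (h0 : lpNorm p x ^ p ≠ 0) : 0 < F := by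
  have h1 := lt_of_le_of_ne (Real.rpow_nonneg (lpNorm_nonneg (by linarith : 0 < p) x) p) h0.symm
  exact pos_of_mul_pos_right (h1.trans_le (h.lpNorm_rpow_le_isGLB hp hn hF))
    (Real.rpow_nonneg (Nat.cast_nonneg n) _)

lemma IsLeastNormSolution.refineInv (h : IsLeastNormSolution A b x) (hp : 2 ≤ p) :
    RefineInv A b p x (lpNorm p x ^ p / (16 * p)) where
  sol := h.1
  gap y _ := by
    have hp0 : 0 < p := by linarith
    have h1 := Real.rpow_nonneg (lpNorm_nonneg hp0 y) p
    have h2 : 16 * p * (lpNorm p x ^ p / (16 * p)) = lpNorm p x ^ p := by field_simp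
    linarith

lemma IsLeastNormSolution.refineBound (h : IsLeastNormSolution A b x) (hp : 2 ≤ p)
    (hn : 2 ≤ n) (hε : 0 < ε)
    (hF : IsGLB ((fun y => lpNorm p y ^ p) '' {y | A *ᵥ y = b}) F)
    (h0 : lpNorm p x ^ p ≠ 0) :
    RefineBound A b p ε F x (lpNorm p x ^ p / (16 * p)) := by
  refine ⟨h.refineInv hp, ?_⟩
  have hp0 : 0 < p := by linarith
  have h1 : F ≤ lpNorm p x ^ p := hF.1 ⟨x, h.1, rfl⟩
  have h2 := h.pos_of_isGLB hp hn hF h0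
  have h3 : minBound p ε F = ε / (1 + ε) * (F / (16 * p)) := by
    unfold minBound
    field_simp
  have h4 : F / (16 * p) ≤ lpNorm p x ^ p / (16 * p) := by gcongr
  have h5 : ε / (1 + ε) ≤ 1 := (div_le_one (by linarith)).2 (by linarith)
  have h6 : 0 < F / (16 * p) := by positivity
  have h7 := mul_le_mul_of_nonneg_right h5 h6.le
  rw [h3]
  linarith

/-- If the initial iterate vanishes, then so does the initial `M`, and the loop exits at once. -/
lemma exit_of_lpNorm_rpow_eq_zero (h0 : lpNorm p x ^ p = 0) :
    lpNorm p x ^ p / (16 * p) ≤ ε / (16 * p * (1 + ε)) * lpNorm p x ^ p := by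
  rw [h0, zero_div, mul_zero]

lemma exists_run (hsolve : SolvesSystems A solve) (hn : 2 ≤ n) (hp : 2 ≤ p) (hε : 0 < ε)
    (hb : ∃ x, A *ᵥ x = b) : ∃ log y, Run A b p ε solve log y := by
  obtain ⟨F, hF⟩ := exists_isGLB_lpNorm_rpow (by linarith : 0 < p) hb
  obtain ⟨x₀, hx₀⟩ := exists_isLeastNormSolution hb
  by_cases h0 : lpNorm p x₀ ^ p = 0
  · exact ⟨[], x₀, x₀, hx₀, .exit _ _ (exit_of_lpNorm_rpow_eq_zero h0)⟩
  · obtain ⟨m, hm⟩ := exists_nat_gt (refinePotential n p ε F x₀ (lpNorm p x₀ ^ p / (16 * p)))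
    obtain ⟨log, y, hy⟩ := exists_refineLoop hsolve hn hp hε hF (hx₀.pos_of_isGLB hp hn hF h0) m
      x₀ _ (hx₀.refineBound hp hn hε hF h0) hm
    exact ⟨log, y, x₀, hx₀, hy⟩

lemma Run.length_le (hsolve : SolvesSystems A solve) (hn : 2 ≤ n) (hp : 2 ≤ p) (hε : 0 < ε)
    (hε1 : ε ≤ 1) (hb : ∃ x, A *ᵥ x = b) {log : List (List (SystemQuery n))}
    (hrun : Run A b p ε solve log y) :
    (log.length : ℝ) ≤ 30000 * (p ^ 2 * Real.log n * Real.log (n / ε)) := by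
  obtain ⟨F, hF⟩ := exists_isGLB_lpNorm_rpow (by linarith : 0 < p) hb
  obtain ⟨x₀, hx₀, hloop⟩ := hrun
  by_cases h0 : lpNorm p x₀ ^ p = 0
  · have hexit := exit_of_lpNorm_rpow_eq_zero (ε := ε) h0
    have hnil : log = [] := by
      generalize lpNorm p x₀ ^ p / (16 * p) = M at hloop hexit
      cases hloop with
      | exit => rfl
      | halve _ _ _ _ _ _ hM => exact absurd hexit (not_le.2 hM)
      | step _ _ _ _ _ _ hM => exact absurd hexit (not_le.2 hM)
    have h1 := Real.log_natCast_nonneg n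
    have h2 : 0 ≤ Real.log (n / ε) := Real.log_nonneg (by
      rw [one_le_div hε]
      have : (2 : ℝ) ≤ n := by exact_mod_cast hn
      linarith)
    rw [hnil, List.length_nil, Nat.cast_zero]
    positivity
  · exact (hloop.length_le hsolve hn hp hε hF (hx₀.pos_of_isGLB hp hn hF h0)
      (hx₀.refineBound hp hn hε hF h0)).trans
      (refinePotential_initial_le hn hp hε hε1 (hx₀.pos_of_isGLB hp hn hF h0)
        (hF.1 ⟨x₀, hx₀.1, rfl⟩) (hx₀.lpNorm_rpow_le_isGLB hp hn hF))

end

end LpIRLS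

end

theorem theorem2 :
    ∃ C : ℝ, 0 < C ∧
      ∀ p : ℝ, 2 ≤ p →
      ∀ (d n : ℕ), 2 ≤ n →
      ∀ (A : Matrix (Fin d) (Fin n) ℝ) (b : Fin d → ℝ), (∃ x : Fin n → ℝ, A *ᵥ x = b) →
      ∀ ε : ℝ, 0 < ε → ε ≤ 1 →
      ∀ solve : LpIRLS.SystemQuery n → Fin (d + 1) → ℝ, LpIRLS.SolvesSystems A solve →
        (∃ log x, LpIRLS.Run A b p ε solve log x) ∧
        ∀ log x, LpIRLS.Run A b p ε solve log x →
          A *ᵥ x = b ∧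
          (∀ y : Fin n → ℝ, A *ᵥ y = b →
            LpIRLS.lpNorm p x ≤ (1 + ε) * LpIRLS.lpNorm p y) ∧
          (log.length : ℝ) ≤ C * (p ^ 2 * Real.log n * Real.log (n / ε)) ∧
          ∀ L ∈ log,
            (L.length : ℝ) ≤ C * (n : ℝ) ^ ((p - 2) / (3 * p - 2)) ∧
            ∀ Q ∈ L, Q.WellFormed := by
  refine ⟨30000, by norm_num, fun p hp d n hn A b hb ε hε hε1 solve hsolve =>
    ⟨LpIRLS.exists_run hsolve hn hp hε hb, fun log x hrun => ?_⟩⟩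
  have hlength := LpIRLS.Run.length_le hsolve hn hp hε hε1 hb hrun
  obtain ⟨x₀, hx₀, hloop⟩ := hrun
  obtain ⟨⟨h1, h2⟩, h3⟩ := hloop.correct hsolve hn hp hε (hx₀.refineInv hp)
  refine ⟨h1, h2, hlength, fun L hL => ⟨(h3 L hL).1.trans ?_, (h3 L hL).2⟩⟩
  exact mul_le_mul_of_nonneg_right (by norm_num) (Real.rpow_nonneg (Nat.cast_nonneg n) _)
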